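/- Let $M$ be a connected oriented smooth manifold of even dimension $2m\ge 2$ and let $g,\widetilde g$ be two Riemannian metrics on $M$ with Levi-Civita connections $\nabla,\widetilde\nabla$. For $p\in M$ let $C=C(p)$ be the endomorphism of $T_pM$ with $g(CX,Y)=\widetilde g(X,Y)$ for all $X,Y\in T_pM$. It is $g$-symmetric and positive; let $Q=Q(p)$ be its principal square root, i.e. the unique $g$-symmetric positive endomorphism of $T_pM$ with $Q^2=C$. Let $\mathcal Z\subset Hom(TM,TM)$ be the positive twistor space of $(M,g)$: its fibre over $p$ consists of the $g$-orthogonal complex structures $J$ on $T_pM$ ($J^2=-Id$, $g(JX,JY)=g(X,Y)$) that induce the given orientation of $T_pM$, i.e. such that some basis of the form $e_1,Je_1,\dots,e_m,Je_m$ is positively oriented. The connection on $Hom(TM,TM)$ induced by $\nabla$ gives a splitting $T_J\mathcal Z=\mathcal H_J\oplus\mathcal V_J$ into the horizontal space $\mathcal H_J$, which the differential $\pi_*$ of the projection $\pi:\mathcal Z\to M$ identifies with $T_{\pi(J)}M$, and the vertical space $\mathcal V_J\subset Hom(T_{\pi(J)}M,T_{\pi(J)}M)$. The Atiyah-Hitchin-Singer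 almost complex structure $\mathcal J_1$ of $\mathcal Z$ is given at $J$ by $$\mathcal J_1(X^h_J)=(JX)^h_J\quad (X\in T_{\pi(J)}M),\qquad \mathcal J_1 U=J\circ U\quad (U\in\mathcal V_J),$$ where $X^h_J\in\mathcal H_J$ is the horizontal lift of $X$. Let $\widetilde{\mathcal Z}$ and $\widetilde{\mathcal J}_1$ be the corresponding objects for $(M,\widetilde g)$, with the same orientation of $M$, defined with $\widetilde\nabla$. Let $$\Psi:\mathcal Z\to\widetilde{\mathcal Z},\qquad \Psi(I)=Q^{-1}IQ .$$ A smooth map $\varphi:(N,J)\to(\widetilde N,\widetilde J)$ of almost complex manifolds is holomorphic if $\widetilde J\circ\varphi_*=\varphi_*\circ J$, and anti-holomorphic if $\widetilde J\circ\varphi_*=-\varphi_*\circ J$. Then: (i) $\Psi:(\mathcal Z,\mathcal J_1)\to(\widetilde{\mathcal Z},\widetilde{\mathcal J}_1)$ is holomorphic if and only if $C=e^{2f}Id$ for a smooth function $f$ on $M$, i.e. the metrics are conformal with $\widetilde g=e^{2f}g$. In this case $\mathcal Z=\widetilde{\mathcal Z}$ and $\Psi=Id$. (ii) $\Psi:(\mathcal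 Z,\mathcal J_1)\to(\widetilde{\mathcal Z},\widetilde{\mathcal J}_1)$ is never anti-holomorphic. -/

import Mathlib

open Bundle Set
open scoped Manifold ContDiff Topology

noncomputable section

namespace Twistor

/-- On a finite-dimensional real vector space with an inner product `B`, a `B`-symmetric positive
endomorphism `C` has a unique `B`-symmetric positive square root. -/
theorem existsUnique_sqrt {V : Type*} [AddCommGroup V] [Module ℝ V] [FiniteDimensional ℝ V]
    (B : V →ₗ[ℝ] V →ₗ[ℝ] ℝ) (hs : ∀ x y, B x y = B y x) (hp : ∀ x, x ≠ 0 → 0 < B x x)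
    (C : V →ₗ[ℝ] V) (hCs : ∀ x y, B (C x) y = B x (C y)) (hCp : ∀ x, x ≠ 0 → 0 < B (C x) x) :
    ∃! Q : V ≃ₗ[ℝ] V, (∀ x y, B (Q x) y = B x (Q y)) ∧ (∀ x, x ≠ 0 → 0 < B (Q x) x) ∧
      ∀ x, Q (Q x) = C x := by
  let core : InnerProductSpace.Core ℝ V :=
    { inner := fun x y => B x y
      conj_inner_symm := fun x y => by simpa using hs y x
      re_inner_nonneg := fun x => by
        rcases eq_or_ne x 0 with rfl | h
        · simp
        · simpa using (hp x h).le
      add_left := fun x y z => by simp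
      smul_left := fun x y r => by simp
      definite := fun x h => by
        by_contra h0
        exact (hp x h0).ne' h }
  let _ : NormedAddCommGroup V := core.toNormedAddCommGroup
  let _ : InnerProductSpace ℝ V := InnerProductSpace.ofCore core.toCore
  have hC : C.IsSymmetric := fun x y => hCs x y
  let b := hC.eigenvectorBasis rfl
  let ev := hC.eigenvalues rfl
  have hb : ∀ i, C (b i) = ev i • b i := fun i => hC.apply_eigenvectorBasis rfl i
  have hbne : ∀ i, b i ≠ 0 := fun i => b.orthonormal.ne_zero i
  have hev : ∀ i, 0 < ev i := fun i => by
    have h := hCp (b i) (hbne i)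
    rw [hb] at h
    simp only [map_smul, LinearMap.smul_apply, smul_eq_mul] at h
    exact (pos_iff_pos_of_mul_pos h).2 (hp _ (hbne i))
  have key : ∀ c : Fin (Module.finrank ℝ V) → ℝ, ∃ q : V →ₗ[ℝ] V,
      (∀ i, q (b i) = c i • b i) ∧ ∀ x y, B (q x) y = B x (q y) := by
    intro c
    let q : V →ₗ[ℝ] V := b.toBasis.constr ℝ (fun i => c i • b i)
    have hq : ∀ i, q (b i) = c i • b i := fun i => by
      have := b.toBasis.constr_basis ℝ (fun i => c i • b i) i
      simpa only [OrthonormalBasis.coe_toBasis] using this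
    refine ⟨q, hq, fun x y => ?_⟩
    have : B ∘ₗ q = (LinearMap.compl₁₂ B LinearMap.id q) := by
      apply b.toBasis.ext
      intro i
      apply b.toBasis.ext
      intro j
      have hij : B (b i) (b j) = if i = j then 1 else 0 :=
        (orthonormal_iff_ite.1 b.orthonormal) i j
      simp only [OrthonormalBasis.coe_toBasis, LinearMap.comp_apply, LinearMap.compl₁₂_apply,
        LinearMap.id_apply, hq, map_smul, LinearMap.smul_apply, hij, smul_eq_mul]
      by_cases h : i = j
      · subst h; simp
      · simp [h]
    exact LinearMap.congr_fun (LinearMap.congr_fun this x) y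
  obtain ⟨q, hq, hsym⟩ := key (fun i => √(ev i))
  obtain ⟨r, hr, hrsym⟩ := key (fun i => √√(ev i))
  have hqq : ∀ x, q (q x) = C x := by
    have : q ∘ₗ q = C := by
      apply b.toBasis.ext
      intro i
      simp only [OrthonormalBasis.coe_toBasis, LinearMap.comp_apply, hq, map_smul, hb, smul_smul,
        Real.mul_self_sqrt (hev i).le]
    exact LinearMap.congr_fun this
  have hrr : ∀ x, r (r x) = q x := by
    have : r ∘ₗ r = q := by
      apply b.toBasis.ext
      intro i
      simp only [OrthonormalBasis.coe_toBasis, LinearMap.comp_apply, hq, hr, map_smul, smul_smul,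
        Real.mul_self_sqrt (Real.sqrt_nonneg (ev i))]
    exact LinearMap.congr_fun this
  have hq0 : ∀ x, q x = 0 → x = 0 := by
    intro x hx
    by_contra h0
    have := hCp x h0
    rw [← hqq, hx] at this
    simp at this
  have hpos : ∀ x, x ≠ 0 → 0 < B (q x) x := by
    intro x hx
    rw [← hrr, hrsym]
    apply hp
    intro h
    exact hx (hq0 x (by rw [← hrr, h, map_zero]))
  have hinj : Function.Injective q := by
    rw [← LinearMap.ker_eq_bot, LinearMap.ker_eq_bot']
    exact hq0
  refine ⟨LinearEquiv.ofInjectiveEndo q hinj, ⟨fun x y => ?_, fun x hx => ?_, fun x => ?_⟩, ?_⟩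
  · simpa using hsym x y
  · simpa using hpos x hx
  · simpa using hqq x
  · rintro Q ⟨hQs, hQp, hQQ⟩
    have hD : ((Q : V →ₗ[ℝ] V) - q).IsSymmetric := fun x y => by
      change B (Q x - q x) y = B x (Q y - q y)
      rw [map_sub, map_sub, LinearMap.sub_apply, hQs, hsym]
    have h0 : (Q : V →ₗ[ℝ] V) - q = 0 := by
      let d := hD.eigenvectorBasis rfl
      apply d.toBasis.ext
      intro i
      have hd : Q (d i) - q (d i) = hD.eigenvalues rfl i • d i := hD.apply_eigenvectorBasis rfl i
      set μ := hD.eigenvalues rfl i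
      have hdne : d i ≠ 0 := d.orthonormal.ne_zero i
      have e1 : B (Q (Q (d i))) (d i) = B (q (q (d i))) (d i) := by rw [hQQ, hqq]
      have e2 : q (d i) = Q (d i) - μ • d i := by rw [← hd]; abel
      have e3 : B (Q (Q (d i))) (d i) = B (q (d i)) (Q (d i)) + μ * B (Q (d i)) (d i) := by
        rw [e2, hQs]
        simp only [map_sub, map_smul, LinearMap.sub_apply, LinearMap.smul_apply, smul_eq_mul]
        rw [hs (d i) (Q (d i))]
        ring
      have e4 : B (q (q (d i))) (d i) = B (q (d i)) (Q (d i)) - μ * B (q (d i)) (d i) := by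
        rw [hsym]
        nth_rewrite 2 [e2]
        simp only [map_sub, map_smul, smul_eq_mul]
      have e5 : μ * (B (Q (d i)) (d i) + B (q (d i)) (d i)) = 0 := by linarith
      have e6 : μ = 0 := by
        rcases mul_eq_zero.1 e5 with h | h
        · exact h
        · linarith [hQp _ hdne, hpos _ hdne]
      simp only [OrthonormalBasis.coe_toBasis, LinearMap.zero_apply, LinearMap.sub_apply,
        LinearEquiv.coe_coe]
      rw [hd, e6, zero_smul]
    ext x
    have := LinearMap.congr_fun h0 x
    simpa [sub_eq_zero] using this

end Twistor
set_option linter.unusedSectionVars false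

namespace Twistor

section Setting

variable {E : Type*} [NormedAddCommGroup E] [NormedSpace ℝ E]
  {M : Type*} [TopologicalSpace M] [ChartedSpace E M]

instance [FiniteDimensional ℝ E] (p : M) : FiniteDimensional ℝ (TangentSpace 𝓘(ℝ, E) p) :=
  inferInstanceAs (FiniteDimensional ℝ E)

instance (p : M) : T2Space (TangentSpace 𝓘(ℝ, E) p) :=
  inferInstanceAs (T2Space E)

/-- Endomorphisms of the tangent space at `p`. -/
abbrev EndFiber (p : M) : Type _ :=
  TangentSpace 𝓘(ℝ, E) p →L[ℝ] TangentSpace 𝓘(ℝ, E) p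

variable (E M) in
/-- The total space of the vector bundle `Hom(TM, TM)`. -/
abbrev EndBundle : Type _ :=
  TotalSpace (E →L[ℝ] E) (fun p : M => EndFiber (E := E) p)

variable (E) in
/-- The model with corners of the manifold `Hom(TM, TM)`. -/
abbrev endModel : ModelWithCorners ℝ (E × (E →L[ℝ] E)) (ModelProd E (E →L[ℝ] E)) :=
  𝓘(ℝ, E).prod 𝓘(ℝ, E →L[ℝ] E)

variable [IsManifold 𝓘(ℝ, E) ∞ M]

variable (E M) in
/-- Smooth Riemannian metrics on `M`. -/
abbrev Metric : Type _ :=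
  ContMDiffRiemannianMetric 𝓘(ℝ, E) ∞ E (fun p : M => TangentSpace 𝓘(ℝ, E) p)

/-- The isomorphism `T_pM → E` given by the trivialization of `TM` over the preferred chart
at `p`. -/
def coords (p : M) : TangentSpace 𝓘(ℝ, E) p ≃L[ℝ] E :=
  (trivializationAt E (TangentSpace 𝓘(ℝ, E)) p).continuousLinearEquivAt ℝ p
    (FiberBundle.mem_baseSet_trivializationAt' p)

/-- `coordField p q v` is the value at `q` of the vector field that has constant components in the
preferred chart at `p` and takes the value `v` at `p`. -/
def coordField (p q : M) : TangentSpace 𝓘(ℝ, E) p →L[ℝ] TangentSpace 𝓘(ℝ, E) q :=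
  (trivializationAt E (TangentSpace 𝓘(ℝ, E)) p).symmL ℝ q ∘L
    (coords (E := E) p).toContinuousLinearMap

theorem coords_apply (p : M) (v : TangentSpace 𝓘(ℝ, E) p) : coords p v =
    (trivializationAt E (TangentSpace 𝓘(ℝ, E)) p).continuousLinearMapAt ℝ p v := by
  rw [← Trivialization.coe_continuousLinearEquivAt_eq' _
    (FiberBundle.mem_baseSet_trivializationAt' p)]
  rfl

theorem coordField_self (p : M) (v : TangentSpace 𝓘(ℝ, E) p) : coordField p p v = v := by
  have := (trivializationAt E (TangentSpace 𝓘(ℝ, E)) p).symmL_continuousLinearMapAt (R := ℝ)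
    (FiberBundle.mem_baseSet_trivializationAt' p) v
  rw [← coords_apply] at this
  exact this

variable (E) in
theorem eventually_mem_baseSet (p : M) :
    ∀ᶠ q in 𝓝 p, q ∈ (trivializationAt E (TangentSpace 𝓘(ℝ, E)) p).baseSet :=
  (trivializationAt E (TangentSpace 𝓘(ℝ, E)) p).open_baseSet.mem_nhds
    (FiberBundle.mem_baseSet_trivializationAt' p)

theorem coordField_eq_extend (p : M) (v : TangentSpace 𝓘(ℝ, E) p) :
    ∀ᶠ q in 𝓝 p, coordField p q v = FiberBundle.extend E v q := by
  filter_upwards [eventually_mem_baseSet E p] with q hq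
  have := Trivialization.symmL_apply (R := ℝ) (trivializationAt E (TangentSpace 𝓘(ℝ, E)) p) hq
  simp [coordField, coords, FiberBundle.extend, this]

theorem mdifferentiableAt_metric (g : Metric E M) (p : M) (Y Z : TangentSpace 𝓘(ℝ, E) p) :
    MDifferentiableAt 𝓘(ℝ, E) 𝓘(ℝ, ℝ)
      (fun q => g.inner q (coordField p q Y) (coordField p q Z)) p := by
  let _ : RiemannianBundle (fun q : M => TangentSpace 𝓘(ℝ, E) q) := ⟨g.toRiemannianMetric⟩
  have h : MDifferentiableAt 𝓘(ℝ, E) 𝓘(ℝ, ℝ)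
      (fun q => g.inner q (FiberBundle.extend E Y q) (FiberBundle.extend E Z q)) p :=
    MDifferentiableAt.inner_bundle (F := E) (E := fun q : M => TangentSpace 𝓘(ℝ, E) q)
      (FiberBundle.mdifferentiableAt_extend 𝓘(ℝ, E) E Y)
      (FiberBundle.mdifferentiableAt_extend 𝓘(ℝ, E) E Z)
  refine h.congr_of_eventuallyEq ?_
  filter_upwards [coordField_eq_extend p Y, coordField_eq_extend p Z] with q h1 h2
  rw [h1, h2]

theorem mvfderiv_const_mul' {f : M → ℝ} {p : M} (hf : MDifferentiableAt 𝓘(ℝ, E) 𝓘(ℝ, ℝ) f p)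
    (c : ℝ) : mvfderiv 𝓘(ℝ, E) (fun q => c * f q) p = c • mvfderiv 𝓘(ℝ, E) f p := by
  have := mvfderiv_fun_mul (mdifferentiableAt_const (I := 𝓘(ℝ, E)) (I' := 𝓘(ℝ, ℝ)) (c := c)) hf
  rw [mvfderiv_const, smul_zero, add_zero] at this
  exact this

/-- `metricDeriv g p Y Z X` is the derivative `X (g(Y, Z))` at `p`, where `Y` and `Z` are extended
with constant components in the chart at `p`. -/
def metricDeriv (g : Metric E M) (p : M) : TangentSpace 𝓘(ℝ, E) p →ₗ[ℝ]
    TangentSpace 𝓘(ℝ, E) p →ₗ[ℝ] TangentSpace 𝓘(ℝ, E) p →ₗ[ℝ] ℝ :=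
  LinearMap.mk₂ ℝ
    (fun Y Z => (mvfderiv 𝓘(ℝ, E)
      (fun q => g.inner q (coordField p q Y) (coordField p q Z)) p).toLinearMap)
    (fun Y Y' Z => by
      have := mvfderiv_fun_add (mdifferentiableAt_metric g p Y Z)
        (mdifferentiableAt_metric g p Y' Z)
      simp only [map_add, add_apply, this]
      rfl)
    (fun c Y Z => by
      have := mvfderiv_const_mul' (mdifferentiableAt_metric g p Y Z) c
      simp only [map_smul, smul_apply, smul_eq_mul, this]
      rfl)
    (fun Y Z Z' => by
      have := mvfderiv_fun_add (mdifferentiableAt_metric g p Y Z)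
        (mdifferentiableAt_metric g p Y Z')
      simp only [map_add, this]
      rfl)
    (fun c Y Z => by
      have := mvfderiv_const_mul' (mdifferentiableAt_metric g p Y Z) c
      simp only [map_smul, smul_eq_mul, this]
      rfl)

theorem metricDeriv_symm (g : Metric E M) (p : M) (Y Z X : TangentSpace 𝓘(ℝ, E) p) :
    metricDeriv g p Y Z X = metricDeriv g p Z Y X := by
  simp only [metricDeriv, LinearMap.mk₂_apply]
  congr 4
  ext q
  exact g.symm q _ _

variable [FiniteDimensional ℝ E]

/-- The isomorphism `X ↦ g(X, ·)` of the tangent space onto the cotangent space. -/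
def flat (g : Metric E M) (p : M) :
    TangentSpace 𝓘(ℝ, E) p ≃ₗ[ℝ] Module.Dual ℝ (TangentSpace 𝓘(ℝ, E) p) :=
  LinearMap.linearEquivOfInjective
    (LinearMap.mk₂ ℝ (fun X Y => g.inner p X Y) (by simp) (by simp) (by simp) (by simp))
    (by
      rw [← LinearMap.ker_eq_bot, LinearMap.ker_eq_bot']
      intro X hX
      by_contra h0
      exact (g.pos p X h0).ne' (LinearMap.congr_fun hX X))
    Subspace.dual_finrank_eq.symm

@[simp] theorem flat_apply (g : Metric E M) (p : M) (X Y : TangentSpace 𝓘(ℝ, E) p) :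
    flat g p X Y = g.inner p X Y := rfl

@[simp] theorem inner_flat_symm (g : Metric E M) (p : M)
    (φ : Module.Dual ℝ (TangentSpace 𝓘(ℝ, E) p)) (Y : TangentSpace 𝓘(ℝ, E) p) :
    g.inner p ((flat g p).symm φ) Y = φ Y := by
  rw [← flat_apply, LinearEquiv.apply_symm_apply]

/-- The functional `Z ↦ ½ (X g(Y, Z) + Y g(X, Z) - Z g(X, Y))` at `p`, for `X`, `Y`, `Z` extended
with constant components in the chart at `p` (these extensions commute, so that this is the
right-hand side of the Koszul formula). -/
def koszul (g : Metric E M) (p : M) : TangentSpace 𝓘(ℝ, E) p →ₗ[ℝ]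
    TangentSpace 𝓘(ℝ, E) p →ₗ[ℝ] Module.Dual ℝ (TangentSpace 𝓘(ℝ, E) p) :=
  LinearMap.mk₂ ℝ
    (fun X Y => (1 / 2 : ℝ) •
      ((metricDeriv g p Y).flip X + (metricDeriv g p X).flip Y - metricDeriv g p X Y))
    (fun X X' Y => by ext Z; simp; ring)
    (fun c X Y => by ext Z; simp; ring)
    (fun X Y Y' => by ext Z; simp; ring)
    (fun c X Y => by ext Z; simp; ring)

/-- The Christoffel symbols of `g` in the preferred chart at `p`, evaluated at `p`:
`christoffel g p X Y` is `∇_X Y` for `Y` extended with constant components. -/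
def christoffel (g : Metric E M) (p : M) :
    TangentSpace 𝓘(ℝ, E) p →ₗ[ℝ] TangentSpace 𝓘(ℝ, E) p →ₗ[ℝ] TangentSpace 𝓘(ℝ, E) p :=
  (koszul g p).compr₂ (flat g p).symm.toLinearMap

theorem inner_christoffel (g : Metric E M) (p : M) (X Y Z : TangentSpace 𝓘(ℝ, E) p) :
    g.inner p (christoffel g p X Y) Z =
      (1 / 2) * (metricDeriv g p Y Z X + metricDeriv g p X Z Y - metricDeriv g p X Y Z) := by
  simp [christoffel, koszul]

theorem christoffel_symm (g : Metric E M) (p : M) (X Y : TangentSpace 𝓘(ℝ, E) p) :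
    christoffel g p X Y = christoffel g p Y X := by
  apply (flat g p).injective
  ext Z
  simp only [flat_apply, inner_christoffel, metricDeriv_symm g p X Y]
  ring

theorem mdifferentiableAt_components {Y : ∀ p : M, TangentSpace 𝓘(ℝ, E) p} {p : M}
    (hY : MDifferentiableAt 𝓘(ℝ, E) (𝓘(ℝ, E).prod 𝓘(ℝ, E))
      (fun q => (⟨q, Y q⟩ : TotalSpace E (fun p : M => TangentSpace 𝓘(ℝ, E) p))) p) :
    MDifferentiableAt 𝓘(ℝ, E) 𝓘(ℝ, E) (fun q =>
      (trivializationAt E (TangentSpace 𝓘(ℝ, E)) p).continuousLinearMapAt ℝ q (Y q)) p := by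
  refine ((mdifferentiableAt_section (IB := 𝓘(ℝ, E)) (F := E) Y).1 hY).congr_of_eventuallyEq ?_
  filter_upwards [eventually_mem_baseSet E p] with q hq
  rw [Trivialization.continuousLinearMapAt_apply, Trivialization.coe_linearMapAt_of_mem _ hq]

/-- The Levi-Civita connection of `g`: at `p`, in the preferred chart at `p`, it is the derivative
of the components plus the Christoffel term. -/
def leviCivita (g : Metric E M) :
    CovariantDerivative 𝓘(ℝ, E) E (fun p : M => TangentSpace 𝓘(ℝ, E) p) where
  toFun Y p :=
    (coords p).symm.toContinuousLinearMap ∘L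
      mvfderiv 𝓘(ℝ, E) (fun q =>
        (trivializationAt E (TangentSpace 𝓘(ℝ, E)) p).continuousLinearMapAt ℝ q (Y q)) p +
    LinearMap.toContinuousLinearMap (christoffel g p (Y p))
  isCovariantDerivativeOnUniv :=
    { add := fun {σ σ' p} hσ hσ' _ => by
        have := mvfderiv_fun_add (mdifferentiableAt_components hσ)
          (mdifferentiableAt_components hσ')
        simp only [Pi.add_apply, map_add, this, ContinuousLinearMap.comp_add]
        abel
      leibniz := fun {σ f p} hσ hf _ => by
        have := mvfderiv_fun_smul hf (mdifferentiableAt_components hσ)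
        have h2 : (coords p).symm ((trivializationAt E (TangentSpace 𝓘(ℝ, E)) p).continuousLinearMapAt
            ℝ p (σ p)) = σ p := by
          rw [← coords_apply, ContinuousLinearEquiv.symm_apply_apply]
        simp only [Pi.smul_apply', map_smul, this]
        ext X
        simp only [add_apply, smul_apply, ContinuousLinearMap.comp_apply, map_add, map_smul,
          ContinuousLinearMap.smulRight_apply, ContinuousLinearEquiv.coe_coe, h2,
          LinearMap.coe_toContinuousLinearMap', smul_add]
        abel }

theorem leviCivita_coordField (g : Metric E M) (p : M) (X Y : TangentSpace 𝓘(ℝ, E) p) :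
    leviCivita g (fun q => coordField p q Y) p X = christoffel g p X Y := by
  have : mvfderiv 𝓘(ℝ, E) (fun q =>
        (trivializationAt E (TangentSpace 𝓘(ℝ, E)) p).continuousLinearMapAt ℝ q
          (coordField p q Y)) p = 0 := by
    have h : (fun q => (trivializationAt E (TangentSpace 𝓘(ℝ, E)) p).continuousLinearMapAt ℝ q
          (coordField p q Y)) =ᶠ[𝓝 p] fun _ => coords p Y := by
      filter_upwards [eventually_mem_baseSet E p] with q hq
      exact Trivialization.continuousLinearMapAt_symmL _ hq _
    unfold mvfderiv
    rw [h.mfderiv_eq]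
    exact mvfderiv_const _
  change ((coords p).symm.toContinuousLinearMap ∘L _) X + christoffel g p _ X = _
  rw [this]
  beta_reduce
  rw [coordField_self, christoffel_symm]
  simp

theorem metricDeriv_eq (g : Metric E M) (p : M) (X Y Z : TangentSpace 𝓘(ℝ, E) p) :
    metricDeriv g p Y Z X =
      g.inner p (christoffel g p X Y) Z + g.inner p Y (christoffel g p X Z) := by
  rw [g.symm p Y, inner_christoffel, inner_christoffel, metricDeriv_symm g p Z Y]
  ring

theorem mpullback_coordField (p : M) (v : TangentSpace 𝓘(ℝ, E) p) :
    ∀ᶠ y in 𝓝 (extChartAt 𝓘(ℝ, E) p p),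
    VectorField.mpullbackWithin 𝓘(ℝ, E) 𝓘(ℝ, E) (extChartAt 𝓘(ℝ, E) p).symm
      (fun q => coordField p q v) (range 𝓘(ℝ, E)) y = (coords p v : E) := by
  filter_upwards [extChartAt_target_mem_nhds (I := 𝓘(ℝ, E)) p] with y hy
  rw [VectorField.mpullbackWithin_apply]
  have hs := (extChartAt 𝓘(ℝ, E) p).map_target hy
  rw [extChartAt_source] at hs
  have h1 := TangentBundle.symmL_trivializationAt (I := 𝓘(ℝ, E)) hs
  rw [(extChartAt 𝓘(ℝ, E) p).right_inv hy] at h1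
  rw [← h1]
  have hb : (extChartAt 𝓘(ℝ, E) p).symm y ∈
    (trivializationAt E (TangentSpace 𝓘(ℝ, E)) p).baseSet := by simpa using hs
  have h2 := Trivialization.symm_continuousLinearEquivAt_eq (R := ℝ)
    (trivializationAt E (TangentSpace 𝓘(ℝ, E)) p) hb
  have h3 : (trivializationAt E (TangentSpace 𝓘(ℝ, E)) p).symmL ℝ ((extChartAt 𝓘(ℝ, E) p).symm y)
    = (((trivializationAt E (TangentSpace 𝓘(ℝ, E)) p).continuousLinearEquivAt ℝ _ hb).symm).toContinuousLinearMap :=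
    DFunLike.coe_injective h2.symm
  change ContinuousLinearMap.inverse ((trivializationAt E (TangentSpace 𝓘(ℝ, E)) p).symmL ℝ ((extChartAt 𝓘(ℝ, E) p).symm y)) ((trivializationAt E (TangentSpace 𝓘(ℝ, E)) p).symmL ℝ ((extChartAt 𝓘(ℝ, E) p).symm y) (coords p v)) = _
  rw [h3, ContinuousLinearMap.inverse_equiv]
  exact ContinuousLinearEquiv.apply_symm_apply _ _

/-- The Levi-Civita connection is torsion-free. -/
theorem leviCivita_torsion (g : Metric E M) : (leviCivita g).torsion = 0 := by
  ext p X Y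
  have hd (v : TangentSpace 𝓘(ℝ, E) p) : MDifferentiableAt 𝓘(ℝ, E) (𝓘(ℝ, E).prod 𝓘(ℝ, E))
      (fun q => (⟨q, coordField p q v⟩ : TotalSpace E (fun p : M => TangentSpace 𝓘(ℝ, E) p))) p := by
    refine (FiberBundle.mdifferentiableAt_extend 𝓘(ℝ, E) E v).congr_of_eventuallyEq ?_
    filter_upwards [coordField_eq_extend p v] with q hq
    rw [hq]
  have h := (leviCivita g).torsion_apply (hd X) (hd Y)
  have hb : VectorField.mlieBracket 𝓘(ℝ, E) (fun q => coordField p q X)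
      (fun q => coordField p q Y) p = 0 := by
    rw [← VectorField.mlieBracketWithin_univ, VectorField.mlieBracketWithin_apply]
    have hX : VectorField.mpullbackWithin 𝓘(ℝ, E) 𝓘(ℝ, E) (extChartAt 𝓘(ℝ, E) p).symm
      (fun q => coordField p q X) (range 𝓘(ℝ, E)) =ᶠ[𝓝 (extChartAt 𝓘(ℝ, E) p p)] fun _ => (coords p X : E) := mpullback_coordField p X
    have hY : VectorField.mpullbackWithin 𝓘(ℝ, E) 𝓘(ℝ, E) (extChartAt 𝓘(ℝ, E) p).symm
      (fun q => coordField p q Y) (range 𝓘(ℝ, E)) =ᶠ[𝓝 (extChartAt 𝓘(ℝ, E) p p)] fun _ => (coords p Y : E) := mpullback_coordField p Y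
    have key : ∀ (V W : E → E) (a b y : E), V =ᶠ[𝓝 y] (fun _ => a) → W =ᶠ[𝓝 y] (fun _ => b) →
        VectorField.lieBracketWithin ℝ V W univ y = 0 := by
      intro V W a b y hV hW
      simp [VectorField.lieBracketWithin, hV.fderiv_eq, hW.fderiv_eq]
    have hz := key _ _ _ _ _ hX hY
    simp only [preimage_univ, univ_inter, modelWithCornersSelf_coe, range_id] at hz ⊢
    exact (congrArg _ hz).trans (map_zero _)
  rw [hb, leviCivita_coordField, leviCivita_coordField, coordField_self, coordField_self,
    christoffel_symm] at h
  simpa using h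

/-- The differential of the projection `π : Hom(TM, TM) → M`. -/
def projDeriv (J : EndBundle E M) :
    TangentSpace (endModel E) J →L[ℝ] TangentSpace 𝓘(ℝ, E) J.proj :=
  mfderiv (endModel E) 𝓘(ℝ, E) (TotalSpace.proj : EndBundle E M → M) J

/-- The fibre coordinate of `Hom(TM, TM)` over the preferred chart at `p`. -/
def fiberCoord (p : M) (A : EndBundle E M) : E →L[ℝ] E :=
  (trivializationAt (E →L[ℝ] E) (fun p : M => EndFiber (E := E) p) p A).2

/-- The differential of the fibre coordinate. -/
def fiberDeriv (J : EndBundle E M) : TangentSpace (endModel E) J →L[ℝ] (E →L[ℝ] E) :=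
  mvfderiv (endModel E) (fiberCoord J.proj) J

/-- The commutator `[Γ(X), J]` of the Christoffel symbols of `g` with an endomorphism `J`. -/
def christoffelBracket (g : Metric E M) (p : M) (J : EndFiber (E := E) p) :
    TangentSpace 𝓘(ℝ, E) p →ₗ[ℝ] EndFiber (E := E) p where
  toFun X := LinearMap.toContinuousLinearMap (christoffel g p X) ∘L J -
      J ∘L LinearMap.toContinuousLinearMap (christoffel g p X)
  map_add' X Y := by
    ext Z
    simp
    abel
  map_smul' c X := by
    ext Z
    simp [smul_sub]

/-- Transport of endomorphisms of the model space `E` to `T_pM` by the coordinates at `p`. -/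
def endOfCoords (p : M) : (E →L[ℝ] E) →ₗ[ℝ] EndFiber (E := E) p where
  toFun B := (coords p).symm.toContinuousLinearMap ∘L B ∘L (coords p).toContinuousLinearMap
  map_add' A B := by
    ext Z
    simp
  map_smul' c A := by
    ext Z
    simp

theorem endOfCoords_eq_zero (p : M) (B : E →L[ℝ] E) (h : endOfCoords p B = 0) : B = 0 := by
  ext v
  have := congr($h ((coords p).symm v))
  simpa [endOfCoords] using this

/-- The connection map `K : T_J Hom(TM, TM) → Hom(T_pM, T_pM)` of the connection induced on
`Hom(TM, TM)` by the Levi-Civita connection of `g`, i.e. the projection onto the vertical space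
along the horizontal one. In coordinates, `K ξ = dA(ξ) + [Γ(π_* ξ), J]`. -/
def connMap (g : Metric E M) (J : EndBundle E M) :
    TangentSpace (endModel E) J →ₗ[ℝ] EndFiber (E := E) J.proj :=
  endOfCoords J.proj ∘ₗ (fiberDeriv J).toLinearMap +
    christoffelBracket g J.proj J.2 ∘ₗ (projDeriv J).toLinearMap

theorem mdifferentiableAt_trivialization (J : EndBundle E M) :
    (trivializationAt (E →L[ℝ] E) (fun p : M => EndFiber (E := E) p)
      J.proj).toOpenPartialHomeomorph.MDifferentiable (endModel E) (endModel E) :=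
  ⟨((trivializationAt (E →L[ℝ] E) (fun p : M => EndFiber (E := E) p)
      J.proj).contMDiffOn (n := ∞)).mdifferentiableOn (by simp),
    ((trivializationAt (E →L[ℝ] E) (fun p : M => EndFiber (E := E) p)
      J.proj).contMDiffOn_symm (n := ∞)).mdifferentiableOn (by simp)⟩

theorem mdifferentiableAt_fiberCoord (J : EndBundle E M) :
    MDifferentiableAt (endModel E) 𝓘(ℝ, E →L[ℝ] E) (fiberCoord J.proj) J :=
  mdifferentiableAt_snd.comp J ((mdifferentiableAt_trivialization J).mdifferentiableAt
    FiberBundle.mem_trivializationAt_proj_source)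

theorem eq_zero_of_deriv (J : EndBundle E M) (ξ : TangentSpace (endModel E) J)
    (h1 : projDeriv J ξ = 0) (h2 : fiberDeriv J ξ = 0) : ξ = 0 := by
  have h := (mdifferentiableAt_trivialization J).ker_mfderiv_eq_bot
    FiberBundle.mem_trivializationAt_proj_source
  rw [LinearMap.ker_eq_bot'] at h
  apply h
  have hp := mfderiv_prodMk (mdifferentiable_proj (E := fun p : M => EndFiber (E := E) p)
    (F := E →L[ℝ] E) (IB := 𝓘(ℝ, E)) J) (mdifferentiableAt_fiberCoord J)
  exact (congr($hp ξ)).trans (Prod.ext h1 h2)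

/-- The connection map takes the differential of a section `S` of `Hom(TM, TM)` to the covariant
derivative `(∇_X S) Y = ∇_X (S Y) - S (∇_X Y)`. -/
theorem connMap_section (g : Metric E M) (p : M) (S : ∀ q : M, EndFiber (E := E) q)
    (hS : MDifferentiableAt 𝓘(ℝ, E) (endModel E) (fun q => (⟨q, S q⟩ : EndBundle E M)) p)
    (X Y : TangentSpace 𝓘(ℝ, E) p) :
    connMap g ⟨p, S p⟩ (mfderiv 𝓘(ℝ, E) (endModel E) (fun q => (⟨q, S q⟩ : EndBundle E M)) p X) Y =
      leviCivita g (fun q => S q (coordField p q Y)) p X -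
        S p (leviCivita g (fun q => coordField p q Y) p X) := by
  set s : M → EndBundle E M := fun q => ⟨q, S q⟩ with hs
  have hproj : projDeriv (s p) (mfderiv 𝓘(ℝ, E) (endModel E) s p X) = X := by
    have h1 := mfderiv_comp_apply p (mdifferentiable_proj (E := fun p : M => EndFiber (E := E) p)
      (F := E →L[ℝ] E) (IB := 𝓘(ℝ, E)) (s p)) hS X
    have h2 : (TotalSpace.proj : EndBundle E M → M) ∘ s = id := rfl
    rw [h2, mfderiv_id] at h1
    exact h1.symm
  have hfib : fiberDeriv (s p) (mfderiv 𝓘(ℝ, E) (endModel E) s p X) =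
      mvfderiv 𝓘(ℝ, E) (fun q => fiberCoord p (s q)) p X :=
    (mfderiv_comp_apply p (mdifferentiableAt_fiberCoord (s p)) hS X).symm
  have hφ : MDifferentiableAt 𝓘(ℝ, E) 𝓘(ℝ, E →L[ℝ] E) (fun q => fiberCoord p (s q)) p :=
    (mdifferentiableAt_fiberCoord (s p)).comp p hS
  have hcomp : (mvfderiv 𝓘(ℝ, E) (fun q => fiberCoord p (s q)) p X) (coords p Y) =
      mvfderiv 𝓘(ℝ, E) (fun q => (trivializationAt E (TangentSpace 𝓘(ℝ, E))
        p).continuousLinearMapAt ℝ q (S q (coordField p q Y))) p X := by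
    have h := ((ContinuousLinearMap.apply ℝ E (coords p Y : E)).hasMFDerivAt.comp p
      hφ.hasMFDerivAt).mfderiv
    exact (congr($h X)).symm
  rw [leviCivita_coordField]
  change endOfCoords p (fiberDeriv (s p) _) Y + christoffelBracket g p (S p) (projDeriv (s p) _) Y
    = (coords p).symm (mvfderiv 𝓘(ℝ, E) (fun q => (trivializationAt E (TangentSpace 𝓘(ℝ, E))
        p).continuousLinearMapAt ℝ q (S q (coordField p q Y))) p X) +
      christoffel g p (S p (coordField p p Y)) X - _
  rw [hproj, hfib, ← hcomp, coordField_self, christoffel_symm g p (S p Y) X]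
  simp [endOfCoords, christoffelBracket]
  abel

theorem split_injective (g : Metric E M) (J : EndBundle E M) :
    Function.Injective ((projDeriv J).toLinearMap.prod (connMap g J)) := by
  rw [← LinearMap.ker_eq_bot, LinearMap.ker_eq_bot']
  intro ξ hξ
  have h1 : projDeriv J ξ = 0 := congrArg Prod.fst hξ
  have h2 : connMap g J ξ = 0 := congrArg Prod.snd hξ
  refine eq_zero_of_deriv J ξ h1 (endOfCoords_eq_zero J.proj _ ?_)
  simpa [connMap, h1] using h2

instance (J : EndBundle E M) : FiniteDimensional ℝ (TangentSpace (endModel E) J) :=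
  inferInstanceAs (FiniteDimensional ℝ (E × (E →L[ℝ] E)))

instance (p : M) : FiniteDimensional ℝ (EndFiber (E := E) p) :=
  inferInstanceAs (FiniteDimensional ℝ (E →L[ℝ] E))

/-- The splitting `T_J Hom(TM, TM) = T_pM ⊕ Hom(T_pM, T_pM)` into the horizontal and the vertical
component. -/
def split (g : Metric E M) (J : EndBundle E M) :
    TangentSpace (endModel E) J ≃ₗ[ℝ] TangentSpace 𝓘(ℝ, E) J.proj × EndFiber (E := E) J.proj :=
  LinearMap.linearEquivOfInjective ((projDeriv J).toLinearMap.prod (connMap g J))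
    (split_injective g J) rfl

/-- The Atiyah-Hitchin-Singer operator at `J`: with respect to the splitting into the horizontal
and the vertical component, `(X, U) ↦ (J X, J ∘ U)`. The Atiyah-Hitchin-Singer almost complex
structure of the twistor space is its restriction to the tangent spaces of the twistor space. -/
def ahs (g : Metric E M) (J : EndBundle E M) :
    TangentSpace (endModel E) J →ₗ[ℝ] TangentSpace (endModel E) J where
  toFun ξ := (split g J).symm (J.2 (split g J ξ).1, J.2 ∘L (split g J ξ).2)
  map_add' ξ η := by
    rw [← map_add]
    simp
  map_smul' c ξ := by
    rw [RingHom.id_apply, ← map_smul]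
    simp

theorem ahs_ahs (g : Metric E M) (J : EndBundle E M) (hJ : ∀ X, J.2 (J.2 X) = -X)
    (ξ : TangentSpace (endModel E) J) : ahs g J (ahs g J ξ) = -ξ := by
  apply (split g J).injective
  change split g J ((split g J).symm (J.2 (split g J ((split g J).symm _)).1, _)) = _
  rw [LinearEquiv.apply_symm_apply, map_neg]
  change (J.2 (split g J ((split g J).symm _)).1, J.2 ∘L (split g J ((split g J).symm _)).2) = _
  rw [LinearEquiv.apply_symm_apply]
  refine Prod.ext (hJ _) ?_
  ext X
  exact hJ _

/-- An orientation of `M` (of dimension `n`): an orientation of each tangent space such that near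
each point there is a smooth positively oriented frame. -/
structure ManifoldOrientation (E M : Type*) [NormedAddCommGroup E] [NormedSpace ℝ E]
    [TopologicalSpace M] [ChartedSpace E M] [IsManifold 𝓘(ℝ, E) ∞ M] (n : ℕ) where
  orient (p : M) : Orientation ℝ (TangentSpace 𝓘(ℝ, E) p) (Fin n)
  exists_frame (p : M) : ∃ v : Fin n → ∀ q : M, TangentSpace 𝓘(ℝ, E) q,
    (∀ i, ContMDiffAt 𝓘(ℝ, E) (𝓘(ℝ, E).prod 𝓘(ℝ, E)) ∞
      (fun q => (⟨q, v i q⟩ : TotalSpace E (fun q : M => TangentSpace 𝓘(ℝ, E) q))) p) ∧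
    ∀ᶠ q in 𝓝 p, ∃ b : Module.Basis (Fin n) ℝ (TangentSpace 𝓘(ℝ, E) q),
      (∀ i, b i = v i q) ∧ b.orientation = orient q

/-- The endomorphism `J` (a complex structure) induces the given orientation: there is a positively
oriented basis of the form `e₁, J e₁, e₂, J e₂, …, eₘ, J eₘ`. -/
def InducesOrientation {m : ℕ} (o : ManifoldOrientation E M (2 * m)) (p : M)
    (J : EndFiber (E := E) p) : Prop :=
  ∃ b : Module.Basis (Fin (2 * m)) ℝ (TangentSpace 𝓘(ℝ, E) p),
    (∀ i : Fin m, b ⟨2 * i + 1, by omega⟩ = J (b ⟨2 * i, by omega⟩)) ∧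
      b.orientation = o.orient p

/-- `I` is a `g`-orthogonal complex structure on `T_pM` that induces the orientation of `M`. -/
def IsPositiveCompatible {m : ℕ} (o : ManifoldOrientation E M (2 * m)) (g : Metric E M) (p : M)
    (I : EndFiber (E := E) p) : Prop :=
  (∀ X, I (I X) = -X) ∧ (∀ X Y, g.inner p (I X) (I Y) = g.inner p X Y) ∧ InducesOrientation o p I

/-- The (positive) twistor space of the oriented Riemannian manifold `(M, g)`, as a subset of
`Hom(TM, TM)`: the `g`-orthogonal complex structures on the tangent spaces that induce the
orientation. -/
def twistorSpace {m : ℕ} (o : ManifoldOrientation E M (2 * m)) (g : Metric E M) :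
    Set (EndBundle E M) :=
  {J | IsPositiveCompatible o g J.proj J.2}

/-- The vectors tangent at `J` to a submanifold `Z` of `Hom(TM, TM)`: the velocities at time `0`
of the smooth curves in `Z` that pass through `J` at time `0`. -/
def tangentVectors (Z : Set (EndBundle E M)) (J : EndBundle E M) :
    Set (TangentSpace (endModel E) J) :=
  {ξ | ∃ γ : ℝ → EndBundle E M, ContMDiffAt 𝓘(ℝ, ℝ) (endModel E) ∞ γ 0 ∧ (∀ᶠ t in 𝓝 0, γ t ∈ Z) ∧
    (⟨γ 0, mfderiv 𝓘(ℝ, ℝ) (endModel E) γ 0 (1 : ℝ)⟩ : TangentBundle (endModel E) (EndBundle E M)) =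
      ⟨J, ξ⟩}

/-- The endomorphism `C` of `T_pM` with `g(C X, Y) = g'(X, Y)`. -/
def metricEndo (g g' : Metric E M) (p : M) :
    TangentSpace 𝓘(ℝ, E) p →ₗ[ℝ] TangentSpace 𝓘(ℝ, E) p :=
  (flat g p).symm.toLinearMap ∘ₗ (flat g' p).toLinearMap

@[simp] theorem inner_metricEndo (g g' : Metric E M) (p : M) (X Y : TangentSpace 𝓘(ℝ, E) p) :
    g.inner p (metricEndo g g' p X) Y = g'.inner p X Y := by
  simp [metricEndo]

theorem existsUnique_metricRoot (g g' : Metric E M) (p : M) :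
    ∃! Q : TangentSpace 𝓘(ℝ, E) p ≃ₗ[ℝ] TangentSpace 𝓘(ℝ, E) p,
      (∀ X Y, g.inner p (Q X) Y = g.inner p X (Q Y)) ∧
      (∀ X, X ≠ 0 → 0 < g.inner p (Q X) X) ∧ ∀ X, Q (Q X) = metricEndo g g' p X :=
  existsUnique_sqrt (flat g p).toLinearMap (g.symm p) (g.pos p) (metricEndo g g' p)
    (fun X Y => by
      change g.inner p (metricEndo g g' p X) Y = g.inner p X (metricEndo g g' p Y)
      rw [g.symm p X, inner_metricEndo, inner_metricEndo, g'.symm])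
    (fun X hX => by
      change 0 < g.inner p (metricEndo g g' p X) X
      rw [inner_metricEndo]
      exact g'.pos p X hX)

/-- The principal square root `Q` of `C`: the unique `g`-symmetric positive endomorphism of `T_pM`
with `Q² = C`. -/
def metricRoot (g g' : Metric E M) (p : M) :
    TangentSpace 𝓘(ℝ, E) p ≃L[ℝ] TangentSpace 𝓘(ℝ, E) p :=
  (existsUnique_metricRoot g g' p).choose.toContinuousLinearEquiv

theorem metricRoot_spec (g g' : Metric E M) (p : M) :
    (∀ X Y, g.inner p (metricRoot g g' p X) Y = g.inner p X (metricRoot g g' p Y)) ∧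
      (∀ X, X ≠ 0 → 0 < g.inner p (metricRoot g g' p X) X) ∧
      ∀ X, metricRoot g g' p (metricRoot g g' p X) = metricEndo g g' p X :=
  (existsUnique_metricRoot g g' p).choose_spec.1

/-- The conjugate `Q⁻¹ A Q` of an endomorphism `A` of `T_pM`. -/
def conjRoot (g g' : Metric E M) (p : M) (A : EndFiber (E := E) p) : EndFiber (E := E) p :=
  (metricRoot g g' p).symm.toContinuousLinearMap ∘L A ∘L
    (metricRoot g g' p).toContinuousLinearMap

theorem conjRoot_apply (g g' : Metric E M) (p : M) (A : EndFiber (E := E) p)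
    (X : TangentSpace 𝓘(ℝ, E) p) :
    conjRoot g g' p A X = (metricRoot g g' p).symm (A (metricRoot g g' p X)) := rfl

/-- The map `Ψ(A) = Q⁻¹ A Q` of `Hom(TM, TM)`. -/
def twistorMap (g g' : Metric E M) (A : EndBundle E M) : EndBundle E M :=
  ⟨A.proj, conjRoot g g' A.proj A.2⟩

theorem det_metricRoot_pos (g g' : Metric E M) (p : M) :
    0 < LinearMap.det (metricRoot g g' p).toLinearEquiv.toLinearMap := by
  obtain ⟨hs, hp, -⟩ := metricRoot_spec g g' p
  obtain ⟨r, ⟨-, -, hr⟩, -⟩ := existsUnique_sqrt (flat g p).toLinearMap (g.symm p) (g.pos p)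
    (metricRoot g g' p).toLinearEquiv.toLinearMap hs hp
  have h : (metricRoot g g' p).toLinearEquiv.toLinearMap = r.toLinearMap ∘ₗ r.toLinearMap := by
    ext X
    exact (hr X).symm
  rw [h, LinearMap.det_comp]
  exact mul_self_pos.2 r.isUnit_det'.ne_zero

theorem isPositiveCompatible_conjRoot {m : ℕ} (hE : Module.finrank ℝ E = 2 * m)
    (o : ManifoldOrientation E M (2 * m)) (g g' : Metric E M) (p : M) (I : EndFiber (E := E) p)
    (hI : IsPositiveCompatible o g p I) : IsPositiveCompatible o g' p (conjRoot g g' p I) := by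
  obtain ⟨h1, h2, b, hb, hbo⟩ := hI
  obtain ⟨hs, -, hQ⟩ := metricRoot_spec g g' p
  have hg' : ∀ X Y, g'.inner p X Y = g.inner p (metricRoot g g' p X) (metricRoot g g' p Y) := by
    intro X Y
    rw [← inner_metricEndo g g', ← hQ, hs]
  refine ⟨fun X => ?_, fun X Y => ?_, b.map (metricRoot g g' p).symm.toLinearEquiv, fun i => ?_, ?_⟩
  · simp [conjRoot_apply, h1]
  · simp [conjRoot_apply, hg', h2]
  · simp [conjRoot_apply, hb]
  · rw [Module.Basis.orientation_map, hbo, Orientation.map_eq_iff_det_pos]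
    · have h := det_metricRoot_pos g g' p
      have h' := LinearEquiv.det_symm_mul_det (metricRoot g g' p).toLinearEquiv
      exact pos_of_mul_pos_left (h'.symm ▸ one_pos) h.le
    · rw [Fintype.card_fin]
      exact hE.symm

/-- `Ψ` maps the twistor space of `g` into the twistor space of `g'`. -/
theorem twistorMap_mapsTo {m : ℕ} (hE : Module.finrank ℝ E = 2 * m)
    (o : ManifoldOrientation E M (2 * m)) (g g' : Metric E M) :
    MapsTo (twistorMap g g') (twistorSpace o g) (twistorSpace o g') :=
  fun A hA => isPositiveCompatible_conjRoot hE o g g' A.proj A.2 hA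

/-- A map `φ` of `Hom(TM, TM)` restricts to a holomorphic map `(Z, 𝒥) → (Z', 𝒥')` between
submanifolds with almost complex structures: it maps `Z` to `Z'`, is smooth, and
`𝒥' ∘ φ_* = φ_* ∘ 𝒥` on the tangent spaces of `Z`. -/
structure IsHolomorphic (Z Z' : Set (EndBundle E M))
    (𝒥 𝒥' : ∀ A : EndBundle E M, TangentSpace (endModel E) A →ₗ[ℝ] TangentSpace (endModel E) A)
    (φ : EndBundle E M → EndBundle E M) : Prop where
  mapsTo : MapsTo φ Z Z'
  smooth : ∀ A ∈ Z, ContMDiffAt (endModel E) (endModel E) ∞ φ A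
  comm : ∀ A ∈ Z, ∀ ξ ∈ tangentVectors Z A,
    𝒥' (φ A) (mfderiv (endModel E) (endModel E) φ A ξ) =
      mfderiv (endModel E) (endModel E) φ A (𝒥 A ξ)

/-- The anti-holomorphic analogue: `𝒥' ∘ φ_* = -φ_* ∘ 𝒥` on the tangent spaces of `Z`. -/
structure IsAntiHolomorphic (Z Z' : Set (EndBundle E M))
    (𝒥 𝒥' : ∀ A : EndBundle E M, TangentSpace (endModel E) A →ₗ[ℝ] TangentSpace (endModel E) A)
    (φ : EndBundle E M → EndBundle E M) : Prop where
  mapsTo : MapsTo φ Z Z'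
  smooth : ∀ A ∈ Z, ContMDiffAt (endModel E) (endModel E) ∞ φ A
  anticomm : ∀ A ∈ Z, ∀ ξ ∈ tangentVectors Z A,
    𝒥' (φ A) (mfderiv (endModel E) (endModel E) φ A ξ) =
      -mfderiv (endModel E) (endModel E) φ A (𝒥 A ξ)

end Setting

end Twistor

end

/-!
The argument separates the horizontal and the vertical part of the Atiyah-Hitchin-Singer operators
`𝒥`, `𝒥'`.

The map `Ψ` preserves the fibres over `M`, so that its differential covers the identity of `TM`
(`projDeriv_mfderiv_twistorMap`), and `π_* ∘ 𝒥 = J ∘ π_*` (`projDeriv_ahs`). Every `X ∈ T_pM` is the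
projection of a vector tangent to the twistor space at a given `J` (`exists_tangentVector`): in a
smooth orthonormal frame near `p`, obtained by the Gram-Schmidt process, the endomorphism with the
constant matrix of `J` is a local section of the twistor space through `J`, which preserves the
orientation because the sign of a determinant is locally constant. Applying `π_*` to
`𝒥' Ψ_* = ± Ψ_* 𝒥` therefore gives `Q⁻¹ J Q = ± J` for every `J` in the twistor space.

With the plus sign, `Q` commutes with all positively oriented orthogonal complex structures of
`T_pM`. Any two vectors of an eigenbasis of `Q` are exchanged up to sign by one of these, hence
`Q` has a single eigenvalue (`eq_smul_of_commute_complexStructure`) and the metrics are conformal;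
the conformal factor is smooth as a quotient of two smooth functions. With the minus sign,
`g(Q J X, J X) = -g(Q X, X)`, which is impossible since `Q` is positive (`not_isAntiHolomorphic`).

Conversely, if `g' = e^{2f} g`, then `Q = e^f` and `Ψ` is the identity, so that only `𝒥 = 𝒥'` on the
twistor space remains (`ahs_eq_of_conformal`). The connections differ by
`α(X) Y = df(X) Y + df(Y) X - g(X, Y) grad f` (`christoffel_conformal`), the connection maps by
`[α(X), J]`, and the identity `[α(J X), J] = J [α(X), J]` for `g`-orthogonal `J` gives `𝒥 = 𝒥'`.
-/

noncomputable section

namespace Twistor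

/-! ### Orthogonal complex structures on a vector space -/

section LinearAlgebra

variable {V : Type*} [AddCommGroup V] [Module ℝ V]

/-- The involution of the indices `0, …, 2m - 1` that exchanges `2i` and `2i + 1`. -/
def pairIndex {m : ℕ} (k : Fin (2 * m)) : Fin (2 * m) :=
  if h : k.val % 2 = 0 then ⟨k.val + 1, by omega⟩ else ⟨k.val - 1, by omega⟩

theorem val_pairIndex {m : ℕ} (k : Fin (2 * m)) :
    (pairIndex k).val = if k.val % 2 = 0 then k.val + 1 else k.val - 1 := by
  unfold pairIndex
  split_ifs <;> rfl

theorem pairIndex_pairIndex {m : ℕ} (k : Fin (2 * m)) : pairIndex (pairIndex k) = k := by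
  ext
  rw [val_pairIndex, val_pairIndex]
  split_ifs <;> omega

/-- A basis `e₀, …, e₂ₘ₋₁` that is orthonormal for the bilinear form `B` determines the
`B`-orthogonal complex structure `e₂ᵢ ↦ e₂ᵢ₊₁`, `e₂ᵢ₊₁ ↦ -e₂ᵢ`. -/
theorem exists_complexStructure_of_orthonormal {m : ℕ} (B : V →ₗ[ℝ] V →ₗ[ℝ] ℝ)
    (e : Module.Basis (Fin (2 * m)) ℝ V) (he : ∀ i j, B (e i) (e j) = if i = j then 1 else 0) :
    ∃ J : V →ₗ[ℝ] V, (∀ x, J (J x) = -x) ∧ (∀ x y, B (J x) (J y) = B x y) ∧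
      ∀ i : Fin m, e ⟨2 * i + 1, by omega⟩ = J (e ⟨2 * i, by omega⟩) := by
  let ε : Fin (2 * m) → ℝ := fun k => if k.val % 2 = 0 then 1 else -1
  have hε (k) : ε k * ε k = 1 := by
    simp only [ε]
    split_ifs <;> norm_num
  have hε' (k) : ε (pairIndex k) = -ε k := by
    simp only [ε, val_pairIndex]
    split_ifs <;> first | omega | norm_num
  let J : V →ₗ[ℝ] V := e.constr ℝ fun k => ε k • e (pairIndex k)
  have hJ (k) : J (e k) = ε k • e (pairIndex k) := e.constr_basis ℝ _ k
  have hinj : Function.Injective (pairIndex (m := m)) :=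
    Function.Involutive.injective pairIndex_pairIndex
  refine ⟨J, fun x => ?_, fun x y => ?_, fun i => ?_⟩
  · have : J ∘ₗ J = -LinearMap.id := by
      apply e.ext
      intro k
      simp [hJ, hε', pairIndex_pairIndex, smul_smul, hε]
    exact LinearMap.congr_fun this x
  · have : B.compl₁₂ J J = B := by
      apply e.ext
      intro i
      apply e.ext
      intro j
      simp only [LinearMap.compl₁₂_apply, hJ, map_smul, LinearMap.smul_apply, he, smul_eq_mul,
        hinj.eq_iff]
      split_ifs with h
      · subst h
        linear_combination hε i
      · simp
    exact LinearMap.congr_fun (LinearMap.congr_fun this x) y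
  · simp [hJ, ε, pairIndex]

/-- `J` is a `B`-orthogonal complex structure that induces the orientation `o`. -/
def IsOrientedComplexStructure {m : ℕ} (B : V →ₗ[ℝ] V →ₗ[ℝ] ℝ)
    (o : Orientation ℝ V (Fin (2 * m))) (J : V →ₗ[ℝ] V) : Prop :=
  (∀ x, J (J x) = -x) ∧ (∀ x y, B (J x) (J y) = B x y) ∧
    ∃ b : Module.Basis (Fin (2 * m)) ℝ V,
      (∀ i : Fin m, b ⟨2 * i + 1, by omega⟩ = J (b ⟨2 * i, by omega⟩)) ∧ b.orientation = o

/-- Two vectors of an orthonormal basis are exchanged up to sign by an orthogonal complex structure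
that induces the given orientation: if the complex structure given by the basis induces the
opposite one, change the sign of one vector. -/
theorem exists_isOrientedComplexStructure {m : ℕ} (hm : 0 < m) (B : V →ₗ[ℝ] V →ₗ[ℝ] ℝ)
    (o : Orientation ℝ V (Fin (2 * m))) (e : Module.Basis (Fin (2 * m)) ℝ V)
    (he : ∀ i j, B (e i) (e j) = if i = j then 1 else 0) (i j : Fin (2 * m)) (hij : i ≠ j) :
    ∃ J, IsOrientedComplexStructure B o J ∧ (J (e i) = e j ∨ J (e i) = -e j) := by
  let z : Fin (2 * m) := ⟨0, by omega⟩
  let u : Fin (2 * m) := ⟨1, by omega⟩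
  have hzu : z ≠ u := by simp [z, u]
  -- A permutation that takes the first two indices to `i` and `j`.
  let σ : Equiv.Perm (Fin (2 * m)) := Equiv.swap z i * Equiv.swap u (Equiv.swap z i j)
  have hz : z ≠ Equiv.swap z i j := fun h => hij (by
    have := congrArg (Equiv.swap z i) h
    simpa using this)
  have hσz : σ z = i := by
    simp [σ, Equiv.swap_apply_of_ne_of_ne hzu hz]
  have hσu : σ u = j := by simp [σ]
  have : Nonempty (Fin (2 * m)) := ⟨z⟩
  let f := (e.reindex σ.symm).adjustToOrientation o
  have hf (k) : f k = e (σ k) ∨ f k = -e (σ k) := by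
    simpa using (e.reindex σ.symm).adjustToOrientation_apply_eq_or_eq_neg o k
  have hfB (k l) : B (f k) (f l) = if k = l then 1 else 0 := by
    by_cases hkl : k = l
    · subst hkl
      rcases hf k with h | h <;> simp [h, he]
    · rcases hf k with h | h <;> rcases hf l with h' | h' <;> simp [h, h', he, hkl]
  obtain ⟨J, h1, h2, h3⟩ := exists_complexStructure_of_orthonormal B f hfB
  refine ⟨J, ⟨h1, h2, f, h3, Module.Basis.orientation_adjustToOrientation _ _⟩, ?_⟩
  have h4 : f u = J (f z) := h3 ⟨0, hm⟩
  rcases hf z with h | h <;> rcases hf u with h' | h' <;> rw [h, h', hσz, hσu] at h4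
  · exact .inl h4.symm
  · exact .inr h4.symm
  · exact .inr (by rw [h4, map_neg, neg_neg])
  · exact .inl (by simpa using h4.symm)

/-- The spectral theorem for an endomorphism that is symmetric for a positive definite form. -/
theorem exists_orthonormal_eigenbasis [FiniteDimensional ℝ V] {n : ℕ}
    (hV : Module.finrank ℝ V = n) (B : V →ₗ[ℝ] V →ₗ[ℝ] ℝ) (hs : ∀ x y, B x y = B y x)
    (hp : ∀ x, x ≠ 0 → 0 < B x x) (Q : V →ₗ[ℝ] V) (hQ : ∀ x y, B (Q x) y = B x (Q y)) :
    ∃ (e : Module.Basis (Fin n) ℝ V) (c : Fin n → ℝ),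
      (∀ i j, B (e i) (e j) = if i = j then 1 else 0) ∧ ∀ i, Q (e i) = c i • e i := by
  let core : InnerProductSpace.Core ℝ V :=
    { inner := fun x y => B x y
      conj_inner_symm := fun x y => by simpa using hs y x
      re_inner_nonneg := fun x => by
        rcases eq_or_ne x 0 with rfl | h
        · simp
        · simpa using (hp x h).le
      add_left := fun x y z => by simp
      smul_left := fun x y r => by simp
      definite := fun x h => by
        by_contra h0
        exact (hp x h0).ne' h }
  let _ : NormedAddCommGroup V := core.toNormedAddCommGroup
  let _ : InnerProductSpace ℝ V := InnerProductSpace.ofCore core.toCore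
  have hC : Q.IsSymmetric := fun x y => hQ x y
  let b := hC.eigenvectorBasis hV
  refine ⟨b.toBasis, hC.eigenvalues hV, fun i j => ?_, fun i => ?_⟩
  · rw [OrthonormalBasis.coe_toBasis]
    exact (orthonormal_iff_ite.1 b.orthonormal) i j
  · rw [OrthonormalBasis.coe_toBasis]
    exact hC.apply_eigenvectorBasis hV i

theorem exists_isOrientedComplexStructure_of_finrank [FiniteDimensional ℝ V] {m : ℕ} (hm : 0 < m)
    (hV : Module.finrank ℝ V = 2 * m) (B : V →ₗ[ℝ] V →ₗ[ℝ] ℝ) (hs : ∀ x y, B x y = B y x)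
    (hp : ∀ x, x ≠ 0 → 0 < B x x) (o : Orientation ℝ V (Fin (2 * m))) :
    ∃ J, IsOrientedComplexStructure B o J := by
  obtain ⟨e, -, he, -⟩ := exists_orthonormal_eigenbasis hV B hs hp LinearMap.id fun x y => rfl
  obtain ⟨J, hJ, -⟩ := exists_isOrientedComplexStructure hm B o e he ⟨0, by omega⟩ ⟨1, by omega⟩
    (by simp)
  exact ⟨J, hJ⟩

/-- A symmetric endomorphism that commutes with all orthogonal complex structures inducing the
orientation is a multiple of the identity, since these exchange, up to sign, any two vectors of an
eigenbasis. -/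
theorem eq_smul_of_commute_complexStructure [FiniteDimensional ℝ V] {m : ℕ} (hm : 0 < m)
    (hV : Module.finrank ℝ V = 2 * m) (B : V →ₗ[ℝ] V →ₗ[ℝ] ℝ) (hs : ∀ x y, B x y = B y x)
    (hp : ∀ x, x ≠ 0 → 0 < B x x) (o : Orientation ℝ V (Fin (2 * m))) (Q : V →ₗ[ℝ] V)
    (hQ : ∀ x y, B (Q x) y = B x (Q y))
    (hJQ : ∀ J, IsOrientedComplexStructure B o J → ∀ x, Q (J x) = J (Q x)) :
    ∃ c : ℝ, ∀ x, Q x = c • x := by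
  obtain ⟨e, c, he, hc⟩ := exists_orthonormal_eigenbasis hV B hs hp Q hQ
  let z : Fin (2 * m) := ⟨0, by omega⟩
  have key : ∀ j, c j = c z := by
    intro j
    rcases eq_or_ne z j with rfl | h
    · rfl
    obtain ⟨J, hJ, hJz⟩ := exists_isOrientedComplexStructure hm B o e he z j h
    have h1 := hJQ J hJ (e z)
    have h2 : c j • e j = c z • e j := by
      rcases hJz with h' | h' <;> simpa [hc, h'] using h1
    exact smul_left_injective ℝ (e.ne_zero j) h2
  refine ⟨c z, fun x => ?_⟩
  have : Q = c z • LinearMap.id := e.ext fun i => by simp [hc, key]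
  exact LinearMap.congr_fun this x

end LinearAlgebra

/-! ### Smooth orthonormal frames and their orientation -/

section GramSchmidt

open InnerProductSpace

variable {EB : Type*} [NormedAddCommGroup EB] [NormedSpace ℝ EB]
  {HB : Type*} [TopologicalSpace HB] {IB : ModelWithCorners ℝ EB HB} {n : ℕ∞ω}
  {B : Type*} [TopologicalSpace B] [ChartedSpace HB B]
  {F : Type*} [NormedAddCommGroup F] [NormedSpace ℝ F]
  {E : B → Type*} [TopologicalSpace (TotalSpace F E)] [∀ x, NormedAddCommGroup (E x)]
  [∀ x, InnerProductSpace ℝ (E x)] [FiberBundle F E] [VectorBundle ℝ F E]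
  [IsContMDiffRiemannianBundle IB n F E]
  {ι : Type*} [LinearOrder ι] [LocallyFiniteOrderBot ι] [WellFoundedLT ι]

/-- The Gram-Schmidt process, applied in each fibre of a Riemannian bundle, preserves smoothness of
sections. -/
theorem contMDiffAt_gramSchmidt {v : ι → ∀ x, E x} {x₀ : B}
    (hv : ∀ i, ContMDiffAt IB (IB.prod 𝓘(ℝ, F)) n (fun x => (⟨x, v i x⟩ : TotalSpace F E)) x₀)
    (hli : LinearIndependent ℝ fun i => v i x₀) (i : ι) :
    ContMDiffAt IB (IB.prod 𝓘(ℝ, F)) n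
      (fun x => (⟨x, gramSchmidt ℝ (fun j => v j x) i⟩ : TotalSpace F E)) x₀ := by
  induction i using WellFoundedLT.induction with
  | ind i ih =>
    have hdef : (fun x => (⟨x, gramSchmidt ℝ (fun j => v j x) i⟩ : TotalSpace F E)) =
        fun x => ⟨x, v i x - ∑ j ∈ Finset.Iio i,
          (inner ℝ (gramSchmidt ℝ (fun j => v j x) j) (v i x) /
            inner ℝ (gramSchmidt ℝ (fun j => v j x) j) (gramSchmidt ℝ (fun j => v j x) j)) •
              gramSchmidt ℝ (fun j => v j x) j⟩ := by
      ext1 x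
      congr 1
      rw [eq_sub_iff_add_eq]
      simp only [real_inner_self_eq_norm_sq]
      exact (gramSchmidt_def'' ℝ (fun j => v j x) i).symm
    rw [hdef]
    refine (hv i).sub_section (.sum_section fun j hj => ?_)
    have hj' := ih j (Finset.mem_Iio.1 hj)
    refine ContMDiffAt.smul_section (ContMDiffAt.div₀ (hj'.inner_bundle (hv i))
      (hj'.inner_bundle hj') ?_) hj'
    exact inner_self_ne_zero.2 (gramSchmidt_ne_zero j hli)

theorem contMDiffAt_gramSchmidtNormed {v : ι → ∀ x, E x} {x₀ : B}
    (hv : ∀ i, ContMDiffAt IB (IB.prod 𝓘(ℝ, F)) n (fun x => (⟨x, v i x⟩ : TotalSpace F E)) x₀)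
    (hli : LinearIndependent ℝ fun i => v i x₀) (i : ι) :
    ContMDiffAt IB (IB.prod 𝓘(ℝ, F)) n
      (fun x => (⟨x, gramSchmidtNormed ℝ (fun j => v j x) i⟩ : TotalSpace F E)) x₀ := by
  have h := contMDiffAt_gramSchmidt hv hli i
  have hne := gramSchmidt_ne_zero i hli
  have hn : ContMDiffAt IB 𝓘(ℝ, ℝ) n (fun x => ‖gramSchmidt ℝ (fun j => v j x) i‖⁻¹) x₀ := by
    simp only [norm_eq_sqrt_real_inner]
    have h0 : inner ℝ (gramSchmidt ℝ (fun j => v j x₀) i) (gramSchmidt ℝ (fun j => v j x₀) i) ≠ 0 :=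
      inner_self_ne_zero.2 hne
    refine ContMDiffAt.inv₀ ?_ ?_
    · exact ((Real.contDiffAt_sqrt h0).contMDiffAt).comp x₀ (h.inner_bundle h)
    · rw [← norm_eq_sqrt_real_inner]
      exact norm_ne_zero_iff.2 hne
  exact hn.smul_section h

end GramSchmidt

section FrameOfMetric

open InnerProductSpace

variable {EB : Type*} [NormedAddCommGroup EB] [NormedSpace ℝ EB]
  {HB : Type*} [TopologicalSpace HB] {IB : ModelWithCorners ℝ EB HB} {n : ℕ∞ω}
  {B : Type*} [TopologicalSpace B] [ChartedSpace HB B]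
  {F : Type*} [NormedAddCommGroup F] [NormedSpace ℝ F]
  {E : B → Type*} [TopologicalSpace (TotalSpace F E)] [∀ b, TopologicalSpace (E b)]
  [∀ b, AddCommGroup (E b)] [∀ b, Module ℝ (E b)] [∀ b, IsTopologicalAddGroup (E b)]
  [∀ b, ContinuousConstSMul ℝ (E b)] [FiberBundle F E] [VectorBundle ℝ F E]
  {ι : Type*} [LinearOrder ι] [LocallyFiniteOrderBot ι] [WellFoundedLT ι]

/-- A smooth local frame can be orthonormalized with respect to a smooth metric. -/
theorem exists_orthonormal_sections (g : ContMDiffRiemannianMetric IB n F E)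
    {v : ι → ∀ x, E x} {x₀ : B}
    (hv : ∀ i, ContMDiffAt IB (IB.prod 𝓘(ℝ, F)) n (fun x => (⟨x, v i x⟩ : TotalSpace F E)) x₀)
    (hli : ∀ᶠ x in 𝓝 x₀, LinearIndependent ℝ fun i => v i x) :
    ∃ w : ι → ∀ x, E x,
      (∀ i, ContMDiffAt IB (IB.prod 𝓘(ℝ, F)) n (fun x => (⟨x, w i x⟩ : TotalSpace F E)) x₀) ∧
      ∀ᶠ x in 𝓝 x₀, (LinearIndependent ℝ fun i => w i x) ∧
        ∀ i j, g.inner x (w i x) (w j x) = if i = j then 1 else 0 := by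
  let _ : RiemannianBundle E := ⟨g.toRiemannianMetric⟩
  refine ⟨fun i x => gramSchmidtNormed ℝ (fun j => v j x) i,
    contMDiffAt_gramSchmidtNormed hv hli.self_of_nhds, ?_⟩
  filter_upwards [hli] with x hx
  have ho := gramSchmidtNormed_orthonormal hx
  exact ⟨ho.linearIndependent, orthonormal_iff_ite.1 ho⟩

end FrameOfMetric

section Determinant

variable {V W : Type*} [AddCommGroup V] [Module ℝ V] [AddCommGroup W] [Module ℝ W]
  {ι : Type*} [Fintype ι] [DecidableEq ι]

theorem orientation_eq_iff_det_mul_det_pos (φ : V ≃ₗ[ℝ] W) (β : Module.Basis ι ℝ W)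
    (a b : Module.Basis ι ℝ V) : a.orientation = b.orientation ↔
      0 < (β.det fun i => φ (a i)) * β.det fun i => φ (b i) := by
  have hc (c : Module.Basis ι ℝ V) : (β.det fun i => φ (c i)) = (β.map φ.symm).det c := by
    rw [Module.Basis.det_map]
    rfl
  rw [hc, hc, Module.Basis.orientation_eq_iff_det_pos,
    ← Module.Basis.det_mul_det (β.map φ.symm) a b, ← mul_assoc]
  exact (mul_pos_iff_of_pos_left (mul_self_pos.2 ((β.map φ.symm).isUnit_det a).ne_zero)).symm

theorem continuousAt_basis_det {F X : Type*} [NormedAddCommGroup F] [NormedSpace ℝ F]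
    [FiniteDimensional ℝ F] [TopologicalSpace X] (β : Module.Basis ι ℝ F) {u : ι → X → F} {x : X}
    (hu : ∀ i, ContinuousAt (u i) x) : ContinuousAt (fun y => β.det fun i => u i y) x := by
  simp only [Module.Basis.det_apply, Matrix.det_apply, Module.Basis.toMatrix_apply]
  have h (i j) : ContinuousAt (fun y => β.repr (u j y) i) x :=
    (LinearMap.continuous_of_finiteDimensional (β.coord i)).continuousAt.comp (hu j)
  exact tendsto_finsetSum _ fun σ _ => (tendsto_finsetProd _ fun i _ => h _ _).const_smul _

end Determinant

section Setting

variable {E : Type*} [NormedAddCommGroup E] [NormedSpace ℝ E]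
  {M : Type*} [TopologicalSpace M] [ChartedSpace E M] [IsManifold 𝓘(ℝ, E) ∞ M]

/-- The vector field `Y` is smooth at `p`. -/
abbrev SmoothFieldAt (Y : ∀ q : M, TangentSpace 𝓘(ℝ, E) q) (p : M) : Prop :=
  ContMDiffAt 𝓘(ℝ, E) (𝓘(ℝ, E).prod 𝓘(ℝ, E)) ∞
    (fun q => (⟨q, Y q⟩ : TotalSpace E (fun q : M => TangentSpace 𝓘(ℝ, E) q))) p

theorem smoothFieldAt_coordField (p : M) (v : TangentSpace 𝓘(ℝ, E) p) :
    SmoothFieldAt (fun q => coordField p q v) p := by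
  refine (FiberBundle.contMDiffAt_extend 𝓘(ℝ, E) E v).congr_of_eventuallyEq ?_
  filter_upwards [coordField_eq_extend p v] with q h1
  rw [h1]

theorem SmoothFieldAt.components {Y : ∀ q : M, TangentSpace 𝓘(ℝ, E) q} {p : M}
    (hY : SmoothFieldAt Y p) : ContMDiffAt 𝓘(ℝ, E) 𝓘(ℝ, E) ∞ (fun q =>
      (trivializationAt E (TangentSpace 𝓘(ℝ, E)) p).continuousLinearMapAt ℝ q (Y q)) p := by
  refine ((contMDiffAt_section (IB := 𝓘(ℝ, E)) (F := E) (s := Y) p).1 hY).congr_of_eventuallyEq ?_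
  filter_upwards [eventually_mem_baseSet E p] with q hq
  rw [Trivialization.continuousLinearMapAt_apply, Trivialization.coe_linearMapAt_of_mem _ hq]

theorem coordField_injective {p q : M}
    (hq : q ∈ (trivializationAt E (TangentSpace 𝓘(ℝ, E)) p).baseSet) :
    Function.Injective (coordField (E := E) p q) := by
  intro x y hxy
  have h (z) := Trivialization.continuousLinearMapAt_symmL (R := ℝ)
    (trivializationAt E (TangentSpace 𝓘(ℝ, E)) p) hq (coords p z)
  apply (coords p).injective
  rw [← h x, ← h y]
  exact congrArg _ hxy

theorem contMDiffAt_inner (g : Metric E M) {p : M} {Y Z : ∀ q : M, TangentSpace 𝓘(ℝ, E) q}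
    (hY : SmoothFieldAt Y p) (hZ : SmoothFieldAt Z p) :
    ContMDiffAt 𝓘(ℝ, E) 𝓘(ℝ, ℝ) ∞ (fun q => g.inner q (Y q) (Z q)) p := by
  let _ : RiemannianBundle (fun q : M => TangentSpace 𝓘(ℝ, E) q) := ⟨g.toRiemannianMetric⟩
  exact ContMDiffAt.inner_bundle (F := E) (E := fun q : M => TangentSpace 𝓘(ℝ, E) q) hY hZ

variable [FiniteDimensional ℝ E]

/-- Near each point there is a smooth orthonormal frame. -/
theorem exists_orthonormal_frame (g : Metric E M) {n : ℕ} (hE : Module.finrank ℝ E = n) (p : M) :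
    ∃ w : Fin n → ∀ q : M, TangentSpace 𝓘(ℝ, E) q, (∀ i, SmoothFieldAt (w i) p) ∧
      ∀ᶠ q in 𝓝 p, ∃ b : Module.Basis (Fin n) ℝ (TangentSpace 𝓘(ℝ, E) q),
        (∀ i, b i = w i q) ∧ ∀ i j, g.inner q (b i) (b j) = if i = j then 1 else 0 := by
  let u : Module.Basis (Fin n) ℝ (TangentSpace 𝓘(ℝ, E) p) := Module.finBasisOfFinrankEq ℝ _ hE
  have hli : ∀ᶠ q in 𝓝 p, LinearIndependent ℝ fun i => coordField p q (u i) := by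
    filter_upwards [eventually_mem_baseSet E p] with q hq
    exact u.linearIndependent.map' (coordField p q).toLinearMap
      (LinearMap.ker_eq_bot.2 (coordField_injective hq))
  obtain ⟨w, hw, hw'⟩ := exists_orthonormal_sections g
    (fun i => smoothFieldAt_coordField p (u i)) hli
  refine ⟨w, hw, ?_⟩
  filter_upwards [hw'] with q ⟨h1, h2⟩
  have hcard : Fintype.card (Fin n) = Module.finrank ℝ (TangentSpace 𝓘(ℝ, E) q) := by
    rw [Fintype.card_fin]
    exact hE.symm
  refine ⟨basisOfLinearIndependentOfCardEqFinrank' _ h1 hcard, fun i => ?_, fun i j => ?_⟩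
  · rw [coe_basisOfLinearIndependentOfCardEqFinrank']
  · rw [coe_basisOfLinearIndependentOfCardEqFinrank']
    exact h2 i j

/-- Two smooth frames that have the same orientation at `p` have the same orientation near
`p`: the sign of their determinants is locally constant. -/
theorem eventually_orientation_eq {n : ℕ} (hE : Module.finrank ℝ E = n) {p : M}
    {u v : Fin n → ∀ q : M, TangentSpace 𝓘(ℝ, E) q} (hu : ∀ i, SmoothFieldAt (u i) p)
    (hv : ∀ i, SmoothFieldAt (v i) p) (a b : Module.Basis (Fin n) ℝ (TangentSpace 𝓘(ℝ, E) p))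
    (ha : ∀ i, a i = u i p) (hb : ∀ i, b i = v i p) (hab : a.orientation = b.orientation) :
    ∀ᶠ q in 𝓝 p, ∀ a b : Module.Basis (Fin n) ℝ (TangentSpace 𝓘(ℝ, E) q),
      (∀ i, a i = u i q) → (∀ i, b i = v i q) → a.orientation = b.orientation := by
  let β : Module.Basis (Fin n) ℝ E := Module.finBasisOfFinrankEq ℝ _ hE
  let e := trivializationAt E (TangentSpace 𝓘(ℝ, E)) p
  let D (u : Fin n → ∀ q : M, TangentSpace 𝓘(ℝ, E) q) (q : M) : ℝ :=
    β.det fun i => e.continuousLinearMapAt ℝ q (u i q)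
  have hD (u : Fin n → ∀ q : M, TangentSpace 𝓘(ℝ, E) q) (hu : ∀ i, SmoothFieldAt (u i) p) :
      ContinuousAt (D u) p :=
    continuousAt_basis_det β fun i => (hu i).components.continuousAt
  have key : ∀ q ∈ e.baseSet, ∀ a b : Module.Basis (Fin n) ℝ (TangentSpace 𝓘(ℝ, E) q),
      (∀ i, a i = u i q) → (∀ i, b i = v i q) →
        (a.orientation = b.orientation ↔ 0 < D u q * D v q) := by
    intro q hq a b ha hb
    have h := orientation_eq_iff_det_mul_det_pos
      (e.continuousLinearEquivAt ℝ q hq).toLinearEquiv β a b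
    simp only [ha, hb] at h
    have hφ (w : TangentSpace 𝓘(ℝ, E) q) : e.continuousLinearMapAt ℝ q w =
        (e.continuousLinearEquivAt ℝ q hq).toLinearEquiv w := by
      rw [← Trivialization.coe_continuousLinearEquivAt_eq' _ hq]
      rfl
    simp only [D, hφ]
    exact h
  have hpos := (key p (FiberBundle.mem_baseSet_trivializationAt' p) a b ha hb).1 hab
  filter_upwards [eventually_mem_baseSet E p,
    ((hD u hu).mul (hD v hv)).eventually (lt_mem_nhds hpos)] with q hq hq' a b ha hb
  exact (key q hq a b ha hb).2 hq'

end Setting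

/-! ### Vectors tangent to the twistor space -/

section Curves

variable {E : Type*} [NormedAddCommGroup E] [NormedSpace ℝ E]
  {M : Type*} [TopologicalSpace M] [ChartedSpace E M] [IsManifold 𝓘(ℝ, E) ∞ M]

/-- Every tangent vector is the velocity of a smooth curve. -/
theorem exists_curve (p : M) (X : TangentSpace 𝓘(ℝ, E) p) :
    ∃ c : ℝ → M, ContMDiffAt 𝓘(ℝ, ℝ) 𝓘(ℝ, E) ∞ c 0 ∧
      (⟨c 0, mfderiv 𝓘(ℝ, ℝ) 𝓘(ℝ, E) c 0 (1 : ℝ)⟩ : TangentBundle 𝓘(ℝ, E) M) = ⟨p, X⟩ := by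
  -- The curve is a straight line in the chart `φ` at `p`. As `c 0 = p` is not definitional, its
  -- velocity is computed in the tangent bundle.
  let φ := extChartAt 𝓘(ℝ, E) p
  have hφ : ContMDiffAt 𝓘(ℝ, E) 𝓘(ℝ, E) ∞ φ p := contMDiffAt_extChartAt
  have hψ : ContMDiffAt 𝓘(ℝ, E) 𝓘(ℝ, E) ∞ φ.symm (φ p) :=
    (contMDiffOn_extChartAt_symm p).contMDiffAt (extChartAt_target_mem_nhds p)
  let v : E := mfderiv 𝓘(ℝ, E) 𝓘(ℝ, E) φ p X
  let l : ℝ → E := fun t => φ p + t • v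
  have hl0 : l 0 = φ p := by simp [l]
  have hl : ContDiff ℝ ∞ l := contDiff_const.add (contDiff_id.smul contDiff_const)
  have hψ' : ContMDiffAt 𝓘(ℝ, E) 𝓘(ℝ, E) ∞ φ.symm (l 0) := hl0 ▸ hψ
  have hld : mfderiv 𝓘(ℝ, ℝ) 𝓘(ℝ, E) l 0 (1 : ℝ) = v := by
    have h : HasDerivAt l v 0 := by
      have := ((hasDerivAt_id (0 : ℝ)).smul_const v).const_add (φ p)
      rwa [one_smul] at this
    rw [mfderiv_eq_fderiv]
    exact h.deriv
  refine ⟨φ.symm ∘ l, hψ'.comp 0 hl.contMDiff.contMDiffAt, ?_⟩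
  have h1 : (⟨l 0, mfderiv 𝓘(ℝ, ℝ) 𝓘(ℝ, E) l 0 (1 : ℝ)⟩ : TangentBundle 𝓘(ℝ, E) E) =
      tangentMap 𝓘(ℝ, E) 𝓘(ℝ, E) φ ⟨p, X⟩ :=
    TotalSpace.ext hl0 (heq_of_eq hld)
  have h2 : (⟨(φ.symm ∘ l) 0, mfderiv 𝓘(ℝ, ℝ) 𝓘(ℝ, E) (φ.symm ∘ l) 0 (1 : ℝ)⟩ :
      TangentBundle 𝓘(ℝ, E) M) = tangentMap 𝓘(ℝ, E) 𝓘(ℝ, E) φ.symm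
        ⟨l 0, mfderiv 𝓘(ℝ, ℝ) 𝓘(ℝ, E) l 0 (1 : ℝ)⟩ :=
    tangentMap_comp_at (p := (⟨0, (1 : ℝ)⟩ : TangentBundle 𝓘(ℝ, ℝ) ℝ))
      (hψ'.mdifferentiableAt (by simp)) (hl.contMDiff.contMDiffAt.mdifferentiableAt (by simp))
  have h3 := tangentMap_comp_at (p := (⟨p, X⟩ : TangentBundle 𝓘(ℝ, E) M))
    (hψ.mdifferentiableAt (by simp)) (hφ.mdifferentiableAt (by simp))
  have h4 : φ.symm ∘ φ =ᶠ[𝓝 p] id := by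
    filter_upwards [extChartAt_source_mem_nhds (I := 𝓘(ℝ, E)) p] with q hq
    exact φ.left_inv hq
  have h5 : mfderiv 𝓘(ℝ, E) 𝓘(ℝ, E) (φ.symm ∘ φ) p X = X := by
    rw [h4.mfderiv_eq, mfderiv_id]
    rfl
  rw [h2, h1, ← h3]
  exact TotalSpace.ext h4.self_of_nhds (heq_of_eq h5)

end Curves

section Sections

variable {E : Type*} [NormedAddCommGroup E] [NormedSpace ℝ E] [FiniteDimensional ℝ E]
  {M : Type*} [TopologicalSpace M] [ChartedSpace E M]

theorem contMDiffAt_clm_of_apply {f : M → E →L[ℝ] E} {p : M}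
    (hf : ∀ v, ContMDiffAt 𝓘(ℝ, E) 𝓘(ℝ, E) ∞ (fun q => f q v) p) :
    ContMDiffAt 𝓘(ℝ, E) 𝓘(ℝ, E →L[ℝ] E) ∞ f p := by
  let β := Module.finBasis ℝ E
  have hdef : f = fun q => ∑ k, ContinuousLinearMap.smulRightL ℝ E E
      (LinearMap.toContinuousLinearMap (β.coord k)) (f q (β k)) := by
    ext q v
    conv_lhs => rw [← β.sum_repr v, map_sum]
    simp only [map_smul, sum_apply, ContinuousLinearMap.smulRightL_apply_apply]
    rfl
  rw [hdef]
  refine contMDiffAt_finsetSum fun k _ => ?_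
  exact (ContinuousLinearMap.contMDiff _).contMDiffAt.comp p (hf (β k))

variable [IsManifold 𝓘(ℝ, E) ∞ M]

/-- A section of `Hom(TM, TM)` is smooth at `p` if it takes the fields with constant components
to smooth fields. -/
theorem contMDiffAt_endSection {S : ∀ q : M, EndFiber (E := E) q} {p : M}
    (hS : ∀ v : TangentSpace 𝓘(ℝ, E) p, SmoothFieldAt (fun q => S q (coordField p q v)) p) :
    ContMDiffAt 𝓘(ℝ, E) (endModel E) ∞ (fun q => (⟨q, S q⟩ : EndBundle E M)) p := by
  refine (contMDiffAt_hom_bundle _).2 ⟨contMDiffAt_id, contMDiffAt_clm_of_apply fun v => ?_⟩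
  refine (hS ((coords p).symm v)).components.congr_of_eventuallyEq (.of_forall fun q => ?_)
  simp [ContinuousLinearMap.inCoordinates, coordField]

/-- Each point of the twistor space lies on a local smooth section of it: it has constant
coefficients in a local smooth orthonormal frame. -/
theorem exists_section_twistorSpace {m : ℕ} (hE : Module.finrank ℝ E = 2 * m)
    (o : ManifoldOrientation E M (2 * m)) (g : Metric E M) (p : M) (I : EndFiber (E := E) p)
    (hI : IsPositiveCompatible o g p I) :
    ∃ S : ∀ q : M, EndFiber (E := E) q, S p = I ∧
      ContMDiffAt 𝓘(ℝ, E) (endModel E) ∞ (fun q => (⟨q, S q⟩ : EndBundle E M)) p ∧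
      ∀ᶠ q in 𝓝 p, (⟨q, S q⟩ : EndBundle E M) ∈ twistorSpace o g := by
  obtain ⟨w, hw, hwb⟩ := exists_orthonormal_frame g hE p
  obtain ⟨a, haw, ha⟩ := hwb.self_of_nhds
  obtain ⟨hI1, hI2, b, hb, hbo⟩ := hI
  obtain ⟨v, hv, hvb⟩ := o.exists_frame p
  obtain ⟨c, hc, hco⟩ := hvb.self_of_nhds
  -- `T x` is the field with the same components in the frame `w` as `x`.
  let T (x : TangentSpace 𝓘(ℝ, E) p) (q : M) : TangentSpace 𝓘(ℝ, E) q := ∑ i, a.repr x i • w i q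
  have hT (x) : SmoothFieldAt (T x) p :=
    .sum_section fun i _ => (hw i).const_smul_section
  -- `S q` is the endomorphism that has in the frame `w q` the matrix of `I` in the frame `w p`.
  let S (q : M) : EndFiber (E := E) q := ∑ j, (g.inner q (w j q)).smulRight (T (I (a j)) q)
  have hSapp (q : M) (y : TangentSpace 𝓘(ℝ, E) q) :
      S q y = ∑ j, g.inner q (w j q) y • T (I (a j)) q := by
    simp [S]
  have hST : ∀ q, (∀ i j, g.inner q (w i q) (w j q) = if i = j then 1 else 0) →
      ∀ x, S q (T x q) = T (I x) q := by
    intro q hq x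
    have h1 (j) : g.inner q (w j q) (T x q) = a.repr x j := by
      simp [T, hq]
    have h2 : I x = ∑ j, a.repr x j • I (a j) := by
      conv_lhs => rw [← a.sum_repr x]
      simp only [map_sum, map_smul]
    rw [hSapp, h2]
    simp only [h1, T, map_sum, map_smul, Finsupp.coe_finsetSum, Finset.sum_apply,
      Finsupp.smul_apply, smul_eq_mul, Finset.smul_sum, Finset.sum_smul, smul_smul]
    exact Finset.sum_comm
  have hTT : ∀ q, (∀ i j, g.inner q (w i q) (w j q) = if i = j then 1 else 0) →
      ∀ x y, g.inner q (T x q) (T y q) = ∑ i, a.repr y i * a.repr x i := by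
    intro q hq x y
    simp [T, hq]
  have hwp (i j) : g.inner p (w i p) (w j p) = if i = j then 1 else 0 := by
    rw [← haw, ← haw, ha]
  have hTp (x) : T x p = x := by
    simp only [T, ← haw]
    exact a.sum_repr x
  refine ⟨S, ?_, contMDiffAt_endSection fun v => ?_, ?_⟩
  · ext x
    have := hST p hwp x
    rwa [hTp, hTp] at this
  · simp only [hSapp]
    exact .sum_section fun j _ => (contMDiffAt_inner g (hw j)
      (smoothFieldAt_coordField p v)).smul_section (hT _)
  · have hor := eventually_orientation_eq hE (u := fun k => T (b k)) (fun k => hT (b k)) hv b c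
      (fun k => (hTp _).symm) hc (hbo.trans hco.symm)
    filter_upwards [hwb, hor, hvb] with q ⟨aq, haq, haqo⟩ horq ⟨cq, hcq, hcqo⟩
    -- The isometry that takes the frame at `p` to the frame at `q` conjugates `I` to `S q`.
    let R : TangentSpace 𝓘(ℝ, E) p ≃ₗ[ℝ] TangentSpace 𝓘(ℝ, E) q := a.equiv aq (Equiv.refl _)
    have hR (x) : R x = T x q := by
      conv_lhs => rw [← a.sum_repr x]
      simp only [map_sum, map_smul, R, T, Module.Basis.equiv_apply, Equiv.refl_apply, haq]
    have hSR (x) : S q (R x) = R (I x) := by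
      rw [hR, hR]
      exact hST q (fun i j => by rw [← haq, ← haq, haqo]) x
    have hRg (x y) : g.inner q (R x) (R y) = g.inner p x y := by
      rw [hR, hR, hTT q (fun i j => by rw [← haq, ← haq, haqo]), ← hTT p hwp, hTp, hTp]
    refine ⟨fun y => ?_, fun y z => ?_, b.map R, fun i => ?_, ?_⟩
    · obtain ⟨x, rfl⟩ := R.surjective y
      simp only [hSR, hI1, map_neg]
    · obtain ⟨x, rfl⟩ := R.surjective y
      obtain ⟨x', rfl⟩ := R.surjective z
      simp only [hSR, hRg, hI2]
    · simp only [Module.Basis.map_apply, hb]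
      exact (hSR _).symm
    · exact (horq (b.map R) cq (fun i => hR _) hcq).trans hcqo

/-- Every tangent vector of `M` at `π(J)` is the projection of a vector tangent to the twistor space
at `J`. -/
theorem exists_tangentVector {m : ℕ} (hE : Module.finrank ℝ E = 2 * m)
    (o : ManifoldOrientation E M (2 * m)) (g : Metric E M) (J : EndBundle E M)
    (hJ : J ∈ twistorSpace o g) (X : TangentSpace 𝓘(ℝ, E) J.proj) :
    ∃ ξ ∈ tangentVectors (twistorSpace o g) J, projDeriv J ξ = X := by
  obtain ⟨S, hSJ, hS, hSZ⟩ := exists_section_twistorSpace hE o g J.proj J.2 hJ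
  obtain ⟨c, hc, hcX⟩ := exists_curve J.proj X
  obtain ⟨p, I⟩ := J
  dsimp only at *
  have hcp : c 0 = p := congrArg TotalSpace.proj hcX
  subst hcp
  subst hSJ
  have hX : mfderiv 𝓘(ℝ, ℝ) 𝓘(ℝ, E) c 0 (1 : ℝ) = X := by
    simpa using hcX
  have hγ : ContMDiffAt 𝓘(ℝ, ℝ) (endModel E) ∞ (fun t => (⟨c t, S (c t)⟩ : EndBundle E M)) 0 :=
    hS.comp 0 hc
  refine ⟨_, ⟨fun t => ⟨c t, S (c t)⟩, hγ, hc.continuousAt.eventually hSZ, rfl⟩, ?_⟩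
  rw [← hX]
  exact (mfderiv_comp_apply 0 (mdifferentiable_proj (E := fun p : M => EndFiber (E := E) p)
    (F := E →L[ℝ] E) (IB := 𝓘(ℝ, E)) _) (hγ.mdifferentiableAt (by simp)) (1 : ℝ)).symm

end Sections

/-! ### Conformal metrics -/

section Conformal

variable {E : Type*} [NormedAddCommGroup E] [NormedSpace ℝ E]
  {M : Type*} [TopologicalSpace M] [ChartedSpace E M] [IsManifold 𝓘(ℝ, E) ∞ M]

theorem twistorSpace_eq_of_conformal {m : ℕ} (o : ManifoldOrientation E M (2 * m))
    (g g' : Metric E M) (f : M → ℝ)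
    (h : ∀ (p : M) (X Y : TangentSpace 𝓘(ℝ, E) p),
      g'.inner p X Y = Real.exp (2 * f p) * g.inner p X Y) :
    twistorSpace o g = twistorSpace o g' := by
  ext A
  simp [twistorSpace, IsPositiveCompatible, h, Real.exp_ne_zero]

theorem metricDeriv_conformal (g g' : Metric E M) {f : M → ℝ}
    (hf : ContMDiff 𝓘(ℝ, E) 𝓘(ℝ, ℝ) ∞ f)
    (h : ∀ (p : M) (X Y : TangentSpace 𝓘(ℝ, E) p),
      g'.inner p X Y = Real.exp (2 * f p) * g.inner p X Y)
    (p : M) (Y Z X : TangentSpace 𝓘(ℝ, E) p) :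
    metricDeriv g' p Y Z X = Real.exp (2 * f p) *
      (metricDeriv g p Y Z X + 2 * mvfderiv 𝓘(ℝ, E) f p X * g.inner p Y Z) := by
  have hfd : MDifferentiableAt 𝓘(ℝ, E) 𝓘(ℝ, ℝ) f p := hf.mdifferentiable (by simp) p
  have hexp : HasDerivAt (fun t : ℝ => Real.exp (2 * t)) (Real.exp (2 * f p) * 2) (f p) := by
    simpa using ((hasDerivAt_id (f p)).const_mul 2).exp
  have he := hexp.hasFDerivAt.hasMFDerivAt.comp p hfd.hasMFDerivAt
  have h1 := mvfderiv_fun_mul he.mdifferentiableAt (mdifferentiableAt_metric g p Y Z)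
  have h2 : mvfderiv 𝓘(ℝ, E) ((fun t : ℝ => Real.exp (2 * t)) ∘ f) p X =
      Real.exp (2 * f p) * 2 * mvfderiv 𝓘(ℝ, E) f p X := by
    have := congr($(he.mfderiv) X)
    refine this.trans ?_
    exact mul_comm (mvfderiv 𝓘(ℝ, E) f p X) (Real.exp (2 * f p) * 2)
  have h3 : metricDeriv g' p Y Z X = mvfderiv 𝓘(ℝ, E) (fun q =>
      ((fun t : ℝ => Real.exp (2 * t)) ∘ f) q *
        g.inner q (coordField p q Y) (coordField p q Z)) p X := by
    simp only [metricDeriv, LinearMap.mk₂_apply, h]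
    rfl
  rw [h3, h1]
  have h4 : metricDeriv g p Y Z X = mvfderiv 𝓘(ℝ, E) (fun q =>
      g.inner q (coordField p q Y) (coordField p q Z)) p X := rfl
  simp only [add_apply, smul_apply, smul_eq_mul, h2, ← h4, coordField_self, Function.comp_apply]
  ring

variable [FiniteDimensional ℝ E]

theorem projDeriv_ahs (g : Metric E M) (J : EndBundle E M) (ξ : TangentSpace (endModel E) J) :
    projDeriv J (ahs g J ξ) = J.2 (projDeriv J ξ) :=
  congrArg Prod.fst ((split g J).apply_symm_apply (J.2 (split g J ξ).1, J.2 ∘L (split g J ξ).2))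

theorem connMap_ahs (g : Metric E M) (J : EndBundle E M) (ξ : TangentSpace (endModel E) J) :
    connMap g J (ahs g J ξ) = J.2 ∘L connMap g J ξ :=
  congrArg Prod.snd ((split g J).apply_symm_apply (J.2 (split g J ξ).1, J.2 ∘L (split g J ξ).2))

theorem eq_of_projDeriv_eq_of_connMap_eq (g : Metric E M) (J : EndBundle E M)
    {ξ η : TangentSpace (endModel E) J} (h1 : projDeriv J ξ = projDeriv J η)
    (h2 : connMap g J ξ = connMap g J η) : ξ = η :=
  split_injective g J (Prod.ext h1 h2)

theorem metricEndo_eq_smul_iff (g g' : Metric E M) (p : M) (c : ℝ) :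
    (∀ X, metricEndo g g' p X = c • X) ↔ ∀ X Y, g'.inner p X Y = c * g.inner p X Y := by
  refine ⟨fun h X Y => ?_, fun h X => ?_⟩
  · rw [← inner_metricEndo g g', h]
    simp
  · apply (flat g p).injective
    ext Y
    simp [h]

/-- If `C` is a multiple of the identity, so is its principal square root. -/
theorem metricRoot_eq_smul (g g' : Metric E M) (p : M) (c : ℝ)
    (h : ∀ X, metricEndo g g' p X = Real.exp (2 * c) • X) (X : TangentSpace 𝓘(ℝ, E) p) :
    metricRoot g g' p X = Real.exp c • X := by
  let R := LinearEquiv.smulOfNeZero ℝ (TangentSpace 𝓘(ℝ, E) p) (Real.exp c) (Real.exp_ne_zero c)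
  have hR (X) : R X = Real.exp c • X := rfl
  have h1 := (existsUnique_metricRoot g g' p).unique (y₁ := (metricRoot g g' p).toLinearEquiv)
    (y₂ := R) (metricRoot_spec g g' p) ⟨fun X Y => by simp [hR], fun X hX => ?_, fun X => ?_⟩
  · exact LinearEquiv.congr_fun h1 X
  · simpa [hR] using mul_pos (Real.exp_pos c) (g.pos p X hX)
  · rw [h, hR, hR, smul_smul, ← Real.exp_add, two_mul]

theorem twistorMap_eq_self_of_conformal (g g' : Metric E M) (f : M → ℝ)
    (h : ∀ p X, metricEndo g g' p X = Real.exp (2 * f p) • X) (A : EndBundle E M) :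
    twistorMap g g' A = A := by
  obtain ⟨p, A⟩ := A
  have : conjRoot g g' p A = A := by
    ext X
    rw [conjRoot_apply, ContinuousLinearEquiv.symm_apply_eq, metricRoot_eq_smul g g' p _ (h p),
      metricRoot_eq_smul g g' p _ (h p), map_smul]
  simp only [twistorMap, this]

/-- The gradient of `f` with respect to `g`. -/
def gradient (g : Metric E M) (f : M → ℝ) (p : M) : TangentSpace 𝓘(ℝ, E) p :=
  (flat g p).symm (mvfderiv 𝓘(ℝ, E) f p).toLinearMap

theorem inner_gradient (g : Metric E M) (f : M → ℝ) (p : M) (X : TangentSpace 𝓘(ℝ, E) p) :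
    g.inner p (gradient g f p) X = mvfderiv 𝓘(ℝ, E) f p X :=
  inner_flat_symm g p _ X

/-- The change of the Levi-Civita connection under a conformal change of the metric. -/
theorem christoffel_conformal (g g' : Metric E M) {f : M → ℝ}
    (hf : ContMDiff 𝓘(ℝ, E) 𝓘(ℝ, ℝ) ∞ f)
    (h : ∀ (p : M) (X Y : TangentSpace 𝓘(ℝ, E) p),
      g'.inner p X Y = Real.exp (2 * f p) * g.inner p X Y)
    (p : M) (X Y : TangentSpace 𝓘(ℝ, E) p) :
    christoffel g' p X Y = christoffel g p X Y + g.inner p (gradient g f p) X • Y +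
      g.inner p (gradient g f p) Y • X - g.inner p X Y • gradient g f p := by
  apply (flat g p).injective
  ext Z
  apply mul_left_cancel₀ (Real.exp_ne_zero (2 * f p))
  rw [flat_apply, ← h, inner_christoffel]
  simp only [metricDeriv_conformal g g' hf h, flat_apply, map_add, map_sub, map_smul,
    LinearMap.add_apply, LinearMap.sub_apply, LinearMap.smul_apply, smul_eq_mul, inner_christoffel,
    inner_gradient]
  ring

/-- The Atiyah-Hitchin-Singer operator is conformally invariant: with
`α(X) = Γ'(X) - Γ(X)` the difference of the connections, this amounts to
`[α(J X), J] = J [α(X), J]` for `g`-orthogonal `J`. -/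
theorem ahs_eq_of_conformal (g g' : Metric E M) {f : M → ℝ}
    (hf : ContMDiff 𝓘(ℝ, E) 𝓘(ℝ, ℝ) ∞ f)
    (h : ∀ (p : M) (X Y : TangentSpace 𝓘(ℝ, E) p),
      g'.inner p X Y = Real.exp (2 * f p) * g.inner p X Y)
    (J : EndBundle E M) (hJ : ∀ X, J.2 (J.2 X) = -X)
    (hJg : ∀ X Y, g.inner J.proj (J.2 X) (J.2 Y) = g.inner J.proj X Y)
    (ξ : TangentSpace (endModel E) J) : ahs g' J ξ = ahs g J ξ := by
  have hconn (η : TangentSpace (endModel E) J) (Y) : connMap g' J η Y = connMap g J η Y +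
      (christoffel g' J.proj (projDeriv J η) (J.2 Y) - christoffel g J.proj (projDeriv J η) (J.2 Y))
      - J.2 (christoffel g' J.proj (projDeriv J η) Y - christoffel g J.proj (projDeriv J η) Y) := by
    simp only [connMap, christoffelBracket, LinearMap.add_apply, LinearMap.comp_apply,
      LinearMap.coe_mk, AddHom.coe_mk, add_apply, sub_apply, map_sub,
      ContinuousLinearMap.comp_apply, LinearMap.coe_toContinuousLinearMap',
      ContinuousLinearMap.coe_coe]
    abel
  refine eq_of_projDeriv_eq_of_connMap_eq g' J ?_ ?_
  · rw [projDeriv_ahs, projDeriv_ahs]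
  · rw [connMap_ahs]
    ext Y
    -- An orthogonal complex structure is skew-symmetric.
    have hskew (X) : g.inner J.proj X (J.2 Y) = - g.inner J.proj (J.2 X) Y := by
      rw [← hJg X, hJ, map_neg]
    rw [hconn, connMap_ahs, projDeriv_ahs, ContinuousLinearMap.comp_apply, hconn,
      ContinuousLinearMap.comp_apply]
    simp only [christoffel_conformal g g' hf h, map_add, map_sub, map_smul, hJ, hJg, hskew]
    module

end Conformal

/-! ### Holomorphic and anti-holomorphic maps -/

section Holomorphic

variable {E : Type*} [NormedAddCommGroup E] [NormedSpace ℝ E] [FiniteDimensional ℝ E]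
  {M : Type*} [TopologicalSpace M] [ChartedSpace E M] [IsManifold 𝓘(ℝ, E) ∞ M]

/-- The metric `g` at `p` as a bilinear form. -/
def innerForm (g : Metric E M) (p : M) :
    TangentSpace 𝓘(ℝ, E) p →ₗ[ℝ] TangentSpace 𝓘(ℝ, E) p →ₗ[ℝ] ℝ :=
  (flat g p).toLinearMap

/-- The fibre over `p` of the twistor space, in terms of the bilinear form `g_p`. -/
theorem mem_twistorSpace_of_isOrientedComplexStructure {m : ℕ}
    {o : ManifoldOrientation E M (2 * m)} {g : Metric E M} {p : M}
    {J : TangentSpace 𝓘(ℝ, E) p →ₗ[ℝ] TangentSpace 𝓘(ℝ, E) p}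
    (hJ : IsOrientedComplexStructure (innerForm g p) (o.orient p) J) :
    (⟨p, LinearMap.toContinuousLinearMap J⟩ : EndBundle E M) ∈ twistorSpace o g :=
  hJ

theorem twistorSpace_nonempty {m : ℕ} (hm : 0 < m) (hE : Module.finrank ℝ E = 2 * m)
    (o : ManifoldOrientation E M (2 * m)) (g : Metric E M) [Nonempty M] :
    (twistorSpace o g).Nonempty := by
  obtain ⟨p⟩ := ‹Nonempty M›
  obtain ⟨J, hJ⟩ := exists_isOrientedComplexStructure_of_finrank hm hE (innerForm g p) (g.symm p)
    (g.pos p) (o.orient p)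
  exact ⟨_, mem_twistorSpace_of_isOrientedComplexStructure hJ⟩

/-- `Ψ` preserves the fibres, so that its differential covers the identity of `TM`. -/
theorem projDeriv_mfderiv_twistorMap (g g' : Metric E M) {A : EndBundle E M}
    (h : ContMDiffAt (endModel E) (endModel E) ∞ (twistorMap g g') A)
    (ξ : TangentSpace (endModel E) A) :
    projDeriv (twistorMap g g' A) (mfderiv (endModel E) (endModel E) (twistorMap g g') A ξ) =
      projDeriv A ξ :=
  (mfderiv_comp_apply A (mdifferentiable_proj (E := fun p : M => EndFiber (E := E) p)
    (F := E →L[ℝ] E) (IB := 𝓘(ℝ, E)) (twistorMap g g' A)) (h.mdifferentiableAt (by simp)) ξ).symm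

/-- The horizontal part of the holomorphicity of `Ψ` says that `Ψ` fixes each point of the twistor
space, i.e. that `Q` commutes with it. -/
theorem IsHolomorphic.metricRoot_commute {m : ℕ} (hE : Module.finrank ℝ E = 2 * m)
    {o : ManifoldOrientation E M (2 * m)} {g g' : Metric E M}
    (h : IsHolomorphic (twistorSpace o g) (twistorSpace o g') (ahs g) (ahs g') (twistorMap g g'))
    {A : EndBundle E M} (hA : A ∈ twistorSpace o g) (X : TangentSpace 𝓘(ℝ, E) A.proj) :
    metricRoot g g' A.proj (A.2 X) = A.2 (metricRoot g g' A.proj X) := by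
  obtain ⟨ξ, hξ, rfl⟩ := exists_tangentVector hE o g A hA X
  have h1 := congrArg (projDeriv (twistorMap g g' A)) (h.comm A hA ξ hξ)
  rw [projDeriv_ahs, projDeriv_mfderiv_twistorMap g g' (h.smooth A hA),
    projDeriv_mfderiv_twistorMap g g' (h.smooth A hA), projDeriv_ahs] at h1
  have h2 : conjRoot g g' A.proj A.2 (projDeriv A ξ) = A.2 (projDeriv A ξ) := h1
  rw [conjRoot_apply, ContinuousLinearEquiv.symm_apply_eq] at h2
  exact h2.symm

/-- The horizontal part of anti-holomorphicity would make `Q` anticommute with `J`, which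
contradicts the positivity of `Q`: `g(Q J X, J X) = -g(J Q X, J X) = -g(Q X, X)`. -/
theorem not_isAntiHolomorphic {m : ℕ} (hm : 0 < m) (hE : Module.finrank ℝ E = 2 * m) [Nonempty M]
    (o : ManifoldOrientation E M (2 * m)) (g g' : Metric E M) :
    ¬ IsAntiHolomorphic (twistorSpace o g) (twistorSpace o g') (ahs g) (ahs g')
      (twistorMap g g') := by
  intro h
  obtain ⟨A, hA⟩ := twistorSpace_nonempty hm hE o g
  have : Nontrivial (TangentSpace 𝓘(ℝ, E) A.proj) :=
    Module.nontrivial_of_finrank_pos (R := ℝ) (hE.symm ▸ (by omega : 0 < 2 * m))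
  obtain ⟨X, hX⟩ := exists_ne (0 : TangentSpace 𝓘(ℝ, E) A.proj)
  obtain ⟨ξ, hξ, rfl⟩ := exists_tangentVector hE o g A hA X
  have h1 := (congrArg (projDeriv (twistorMap g g' A)) (h.anticomm A hA ξ hξ)).trans
    (ContinuousLinearMap.map_neg _ _)
  rw [projDeriv_ahs, projDeriv_mfderiv_twistorMap g g' (h.smooth A hA),
    projDeriv_mfderiv_twistorMap g g' (h.smooth A hA), projDeriv_ahs] at h1
  have h2 : conjRoot g g' A.proj A.2 (projDeriv A ξ) = -A.2 (projDeriv A ξ) := h1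
  rw [conjRoot_apply, ContinuousLinearEquiv.symm_apply_eq, map_neg] at h2
  obtain ⟨-, hpos, -⟩ := metricRoot_spec g g' A.proj
  obtain ⟨hJ, hJg, -⟩ := hA
  set X := projDeriv A ξ
  have hJX : A.2 X ≠ 0 := by
    intro h0
    have := hJ X
    rw [h0, map_zero] at this
    exact hX (neg_eq_zero.1 this.symm)
  have h3 := hpos _ hJX
  rw [← neg_eq_iff_eq_neg.2 h2, map_neg, neg_apply, hJg] at h3
  linarith [hpos X hX]

/-- A pointwise conformal factor is automatically smooth, as a quotient `g'(Y, Y) / g(Y, Y)`. -/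
theorem exists_smooth_conformalFactor [Nontrivial E] (g g' : Metric E M)
    (h : ∀ p, ∃ c : ℝ, ∀ X, metricEndo g g' p X = c • X) :
    ∃ f : M → ℝ, ContMDiff 𝓘(ℝ, E) 𝓘(ℝ, ℝ) ∞ f ∧
      ∀ (p : M) (X : TangentSpace 𝓘(ℝ, E) p), metricEndo g g' p X = Real.exp (2 * f p) • X := by
  choose c hc using h
  have hcg (p) := (metricEndo_eq_smul_iff g g' p (c p)).1 (hc p)
  have hquot {p : M} {Y : TangentSpace 𝓘(ℝ, E) p} (hY : Y ≠ 0) :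
      c p = g'.inner p Y Y / g.inner p Y Y := by
    rw [hcg, mul_div_cancel_right₀ _ (g.pos p Y hY).ne']
  have hne (p : M) : ∃ Y : TangentSpace 𝓘(ℝ, E) p, Y ≠ 0 := exists_ne (0 : E)
  have hpos (p : M) : 0 < c p := by
    obtain ⟨Y, hY⟩ := hne p
    rw [hquot hY]
    exact div_pos (g'.pos p Y hY) (g.pos p Y hY)
  have hsmooth (p : M) : ContMDiffAt 𝓘(ℝ, E) 𝓘(ℝ, ℝ) ∞ c p := by
    obtain ⟨Y, hY⟩ := hne p
    have hs := smoothFieldAt_coordField p Y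
    have hdiv := (contMDiffAt_inner g' hs hs).div₀ (contMDiffAt_inner g hs hs)
      (by rw [coordField_self]; exact (g.pos p Y hY).ne')
    refine hdiv.congr_of_eventuallyEq ?_
    filter_upwards [eventually_mem_baseSet E p] with q hq
    refine hquot fun h0 => hY (coordField_injective hq ?_)
    rw [h0, map_zero]
  refine ⟨fun p => Real.log (c p) / 2, fun p => ?_, fun p X => ?_⟩
  · exact (((Real.contDiffAt_log.2 (hpos p).ne').div_const 2).contMDiffAt).comp p (hsmooth p)
  · rw [hc, mul_div_cancel₀ _ two_ne_zero, Real.exp_log (hpos p)]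

/-- If `Ψ` is holomorphic, then the metrics are conformal, because `Q` commutes with all positively
oriented orthogonal complex structures. -/
theorem IsHolomorphic.exists_conformalFactor {m : ℕ} (hm : 0 < m)
    (hE : Module.finrank ℝ E = 2 * m) {o : ManifoldOrientation E M (2 * m)} {g g' : Metric E M}
    (h : IsHolomorphic (twistorSpace o g) (twistorSpace o g') (ahs g) (ahs g')
      (twistorMap g g')) :
    ∃ f : M → ℝ, ContMDiff 𝓘(ℝ, E) 𝓘(ℝ, ℝ) ∞ f ∧
      ∀ (p : M) (X : TangentSpace 𝓘(ℝ, E) p), metricEndo g g' p X = Real.exp (2 * f p) • X := by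
  have : Nontrivial E := Module.nontrivial_of_finrank_pos (R := ℝ) (hE ▸ (by omega : 0 < 2 * m))
  refine exists_smooth_conformalFactor g g' fun p => ?_
  obtain ⟨hs, -, hsq⟩ := metricRoot_spec g g' p
  obtain ⟨c, hc⟩ := eq_smul_of_commute_complexStructure hm hE (innerForm g p) (g.symm p) (g.pos p)
    (o.orient p) (metricRoot g g' p).toLinearEquiv.toLinearMap hs fun J hJ =>
      h.metricRoot_commute hE (mem_twistorSpace_of_isOrientedComplexStructure hJ)
  have hc' (X) : metricRoot g g' p X = c • X := hc X
  exact ⟨c * c, fun X => by rw [← hsq, hc', hc', smul_smul]⟩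

theorem isHolomorphic_of_conformal {m : ℕ} (o : ManifoldOrientation E M (2 * m)) (g g' : Metric E M)
    {f : M → ℝ} (hf : ContMDiff 𝓘(ℝ, E) 𝓘(ℝ, ℝ) ∞ f)
    (h : ∀ (p : M) (X : TangentSpace 𝓘(ℝ, E) p),
      metricEndo g g' p X = Real.exp (2 * f p) • X) :
    IsHolomorphic (twistorSpace o g) (twistorSpace o g') (ahs g) (ahs g') (twistorMap g g') := by
  have hg (p) := (metricEndo_eq_smul_iff g g' p _).1 (h p)
  have hid : twistorMap g g' = id := funext (twistorMap_eq_self_of_conformal g g' f h)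
  rw [hid, ← twistorSpace_eq_of_conformal o g g' f hg]
  refine ⟨mapsTo_id _, fun A _ => contMDiffAt_id, fun A hA ξ _ => ?_⟩
  rw [mfderiv_id]
  exact ahs_eq_of_conformal g g' hf hg A hA.1 hA.2.1 ξ

end Holomorphic

end Twistor

end

theorem mainTheorem1 {E : Type*} [NormedAddCommGroup E] [NormedSpace ℝ E] [FiniteDimensional ℝ E]
    (m : ℕ) (hm : 0 < m) (hE : Module.finrank ℝ E = 2 * m)
    {M : Type*} [TopologicalSpace M] [ChartedSpace E M] [IsManifold 𝓘(ℝ, E) ∞ M]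
    [T2Space M] [SecondCountableTopology M] [ConnectedSpace M]
    (o : Twistor.ManifoldOrientation E M (2 * m)) (g g' : Twistor.Metric E M) :
    (Twistor.IsHolomorphic (Twistor.twistorSpace o g) (Twistor.twistorSpace o g')
        (Twistor.ahs g) (Twistor.ahs g') (Twistor.twistorMap g g') ↔
      ∃ f : M → ℝ, ContMDiff 𝓘(ℝ, E) 𝓘(ℝ, ℝ) ∞ f ∧
        ∀ (p : M) (X : TangentSpace 𝓘(ℝ, E) p),
          Twistor.metricEndo g g' p X = Real.exp (2 * f p) • X) ∧
    (∀ f : M → ℝ,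
      (∀ (p : M) (X : TangentSpace 𝓘(ℝ, E) p),
        Twistor.metricEndo g g' p X = Real.exp (2 * f p) • X) ↔
      ∀ (p : M) (X Y : TangentSpace 𝓘(ℝ, E) p),
        g'.inner p X Y = Real.exp (2 * f p) * g.inner p X Y) ∧
    (Twistor.IsHolomorphic (Twistor.twistorSpace o g) (Twistor.twistorSpace o g')
        (Twistor.ahs g) (Twistor.ahs g') (Twistor.twistorMap g g') →
      Twistor.twistorSpace o g = Twistor.twistorSpace o g' ∧
        ∀ A ∈ Twistor.twistorSpace o g, Twistor.twistorMap g g' A = A) ∧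
    ¬ Twistor.IsAntiHolomorphic (Twistor.twistorSpace o g) (Twistor.twistorSpace o g')
        (Twistor.ahs g) (Twistor.ahs g') (Twistor.twistorMap g g') := by
  refine ⟨⟨fun h => h.exists_conformalFactor hm hE, fun ⟨f, hf, h⟩ =>
    Twistor.isHolomorphic_of_conformal o g g' hf h⟩, fun f => forall_congr' fun p =>
      Twistor.metricEndo_eq_smul_iff g g' p _, fun h => ?_,
    Twistor.not_isAntiHolomorphic hm hE o g g'⟩
  obtain ⟨f, -, hf⟩ := h.exists_conformalFactor hm hE
  exact ⟨Twistor.twistorSpace_eq_of_conformal o g g' f fun p =>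
      (Twistor.metricEndo_eq_smul_iff g g' p _).1 (hf p),
    fun A _ => Twistor.twistorMap_eq_self_of_conformal g g' f hf A⟩
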